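/- **Lemma (Bias).** Let $d\ge 1$, $\mathcal Y=[0,1]$, $\mathcal X=[0,1]^d$. Derivatives on these closed sets are one-sided at the boundary. *Data.* $(y_i,\mathbf x_i)$, $i\ge 1$, are i.i.d. on $\mathcal Y\times\mathcal X$ with a joint Lebesgue density $f$ that is continuous and bounded away from zero on $\mathcal Y\times\mathcal X$. Write $f_{\mathbf x}(\mathbf x)=\int_0^1 f(u,\mathbf x)\,du$, $F(y|\mathbf x)=\int_0^y f(u,\mathbf x)\,du/f_{\mathbf x}(\mathbf x)$ and $\theta_{\mu,\boldsymbol\nu}(y,\mathbf x)=\partial_y^{\mu}\partial_{\mathbf x}^{\boldsymbol\nu}F(y|\mathbf x)$; $\theta_{2,\mathbf 0}$ exists and is continuous on $\mathcal Y\times\mathcal X$. *Kernel and weight.* $K:\mathbb R\to\mathbb R$ is nonnegative, symmetric, supported on $[-1,1]$, Lipschitz continuous and integrates to one; $L(\mathbf v)=\prod_{j=1}^d K(v_j)$. $G$ is continuously differentiable on $[0,1]$ with derivative $g$. *Notation.* Let $\mathfrak p,\mathfrak q\in\mathbb N$, $0\le\mu\le\mathfrak p$, and let $\boldsymbol\nu\in\mathbb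 N^d$ be a multi-index with $|\boldsymbol\nu|\le\mathfrak q$. Put $\mathbf p(u)=(u^k/k!)_{0\le k\le\mathfrak p}$, $\mathbf q(\mathbf v)=(\mathbf v^{\mathbf m}/\mathbf m!)_{|\mathbf m|\le\mathfrak q}$, $\mathbf P=\mathbf pK$, $\mathbf Q=\mathbf qL$; $\mathbf e_\mu,\mathbf e_{\boldsymbol\nu}$ are the standard basis vectors extracting the $\mu$-th entry of $\mathbf p$ and the $\boldsymbol\nu$-th entry of $\mathbf q$. For a bandwidth $h>0$ let $$\mathbf S_y=\int_{(\mathcal Y-y)/h}\mathbf p(u)\mathbf P(u)^{\mathrm T}g(y+hu)\,du,\qquad \mathbf c_{y,\ell}=\int_{(\mathcal Y-y)/h}\frac{u^\ell}{\ell!}\mathbf P(u)g(y+hu)\,du,$$ $$\mathbf S_{\mathbf x}=\int_{(\mathcal X-\mathbf x)/h}\mathbf q(\mathbf v)\mathbf Q(\mathbf v)^{\mathrm T}f_{\mathbf x}(\mathbf x+h\mathbf v)\,d\mathbf v,\qquad \mathbf c_{\mathbf x,\mathbf m}=\int_{(\mathcal X-\mathbf x)/h}\frac{\mathbf v^{\mathbf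 m}}{\mathbf m!}\mathbf Q(\mathbf v)f_{\mathbf x}(\mathbf x+h\mathbf v)\,d\mathbf v,$$ $$\hat{\mathbf S}_y=\frac1{nh}\sum_{i=1}^n\mathbf p\Big(\frac{y_i-y}h\Big)\mathbf P\Big(\frac{y_i-y}h\Big)^{\mathrm T},\qquad \hat{\mathbf S}_{\mathbf x}=\frac1{nh^d}\sum_{i=1}^n\mathbf q\Big(\frac{\mathbf x_i-\mathbf x}h\Big)\mathbf Q\Big(\frac{\mathbf x_i-\mathbf x}h\Big)^{\mathrm T}.$$ *Claim.* Let $h=h_n>0$ be a deterministic sequence with $h\to0$ and $nh^d/\log n\to\infty$ as $n\to\infty$. Suppose that $\theta_{\mu',\boldsymbol\nu'}$ exists and is continuous on $\mathcal Y\times\mathcal X$ for all $\mu'+|\boldsymbol\nu'|=\max\{\mathfrak q+1+\mu,\ \mathfrak p+1+|\boldsymbol\nu|\}$. Fix $y\in\mathcal Y$ with $g(y)\neq0$ and $\mathbf x\in\mathcal X$. Then, as $n\to\infty$, $$\mathbf e_\mu^{\mathrm T}\mathbf S_y^{-1}\left[\frac1{nh^{\mu+|\boldsymbol\nu|}}\sum_{i=1}^n\Big(\int_{\mathcal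 Y}F(u|\mathbf x_i)\frac1h\mathbf P\Big(\frac{u-y}h\Big)dG(u)\Big)\frac1{h^d}\mathbf Q\Big(\frac{\mathbf x_i-\mathbf x}h\Big)^{\mathrm T}\right]\hat{\mathbf S}_{\mathbf x}^{-1}\mathbf e_{\boldsymbol\nu}=\theta_{\mu,\boldsymbol\nu}(y,\mathbf x)+\mathsf B_{\mu,\boldsymbol\nu}(y,\mathbf x)+o_{\mathbb P}\big(h^{\mathfrak q+1-|\boldsymbol\nu|}+h^{\mathfrak p+1-\mu}\big)$$ and $$\mathbf e_\mu^{\mathrm T}\hat{\mathbf S}_y^{-1}\left[\frac1{n^2h^{\mu+|\boldsymbol\nu|}}\sum_{i=1}^n\sum_{j=1}^nF(y_j|\mathbf x_i)\frac1h\mathbf P\Big(\frac{y_j-y}h\Big)\frac1{h^d}\mathbf Q\Big(\frac{\mathbf x_i-\mathbf x}h\Big)^{\mathrm T}\right]\hat{\mathbf S}_{\mathbf x}^{-1}\mathbf e_{\boldsymbol\nu}=\theta_{\mu,\boldsymbol\nu}(y,\mathbf x)+\mathsf B_{\mu,\boldsymbol\nu}(y,\mathbf x)+o_{\mathbb P}\big(h^{\mathfrak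 q+1-|\boldsymbol\nu|}+h^{\mathfrak p+1-\mu}\big),$$ where $$\mathsf B_{\mu,\boldsymbol\nu}(y,\mathbf x)=h^{\mathfrak q+1-|\boldsymbol\nu|}\sum_{|\mathbf m|=\mathfrak q+1}\theta_{\mu,\mathbf m}(y,\mathbf x)\,\mathbf c_{\mathbf x,\mathbf m}^{\mathrm T}\mathbf S_{\mathbf x}^{-1}\mathbf e_{\boldsymbol\nu}+h^{\mathfrak p+1-\mu}\,\theta_{\mathfrak p+1,\boldsymbol\nu}(y,\mathbf x)\,\mathbf c_{y,\mathfrak p+1}^{\mathrm T}\mathbf S_y^{-1}\mathbf e_\mu.$$ -/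

import Mathlib

open MeasureTheory ProbabilityTheory Filter Topology

namespace CondDist

noncomputable section

/-! ### Partial derivatives on the closed unit cube -/

/-- The partial derivative in coordinate `i` of a function on the closed cube `[0,1]^N`
(one-sided at the faces of the cube). -/
def cubePartial {N : ℕ} (i : Fin N) (Φ : (Fin N → ℝ) → ℝ) : (Fin N → ℝ) → ℝ :=
  fun z => derivWithin (fun t => Φ (Function.update z i t)) (Set.Icc 0 1) (z i)

/-- `∂_{i₁} (∂_{i₂} ( ⋯ (∂_{i_k} Φ)))` for the list `[i₁, …, i_k]`. -/
def iterPartial {N : ℕ} : List (Fin N) → ((Fin N → ℝ) → ℝ) → (Fin N → ℝ) → ℝ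
  | [], Φ => Φ
  | i :: w, Φ => cubePartial i (iterPartial w Φ)

/-- The iterated partial derivative `∂_{i₁} (∂_{i₂} ( ⋯ (∂_{i_k} Φ)))` exists at every point of the
closed cube: each successive one-variable (one-sided at the faces) derivative exists. -/
def IterPartialExists {N : ℕ} : List (Fin N) → ((Fin N → ℝ) → ℝ) → Prop
  | [], _ => True
  | i :: w, Φ => IterPartialExists w Φ ∧ ∀ z ∈ Set.Icc (0 : Fin N → ℝ) 1,
      DifferentiableWithinAt ℝ (fun t => iterPartial w Φ (Function.update z i t))
        (Set.Icc 0 1) (z i)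

/-- The list `[0, …, 0, 1, …, 1, …]` in which coordinate `i` occurs `m i` times. -/
def multiWord {N : ℕ} (m : Fin N → ℕ) : List (Fin N) :=
  (List.finRange N).flatMap fun i => List.replicate (m i) i

/-! ### The conditional distribution function and its derivatives -/

/-- Marginal density of the covariates, `f_x(x) = ∫_{[0,1]} f(u, x) du`. -/
def marginalX {d : ℕ} (f : ℝ → (Fin d → ℝ) → ℝ) (x : Fin d → ℝ) : ℝ :=
  ∫ u in Set.Icc (0 : ℝ) 1, f u x

/-- Conditional density `f(y | x) = f(y, x) / f_x(x)`. -/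
def condDensity {d : ℕ} (f : ℝ → (Fin d → ℝ) → ℝ) (y : ℝ) (x : Fin d → ℝ) : ℝ :=
  f y x / marginalX f x

/-- Conditional distribution function `F(y | x) = ∫_0^y f(u | x) du` for `y ∈ [0,1]`. -/
def condCDF {d : ℕ} (f : ℝ → (Fin d → ℝ) → ℝ) (y : ℝ) (x : Fin d → ℝ) : ℝ :=
  ∫ u in Set.Icc (0 : ℝ) y, condDensity f u x

/-- `F(y | x)` as a function of the single variable `z = (y, x) ∈ [0,1]^{1+d}`. -/
def condCDFJoint {d : ℕ} (f : ℝ → (Fin d → ℝ) → ℝ) (z : Fin (d + 1) → ℝ) : ℝ :=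
  condCDF f (z 0) (Fin.tail z)

/-- `θ_{μ,ν}(y, x) = ∂_y^μ ∂_x^ν F(y | x)`. -/
def theta {d : ℕ} (f : ℝ → (Fin d → ℝ) → ℝ) (μ : ℕ) (ν : Fin d → ℕ)
    (y : ℝ) (x : Fin d → ℝ) : ℝ :=
  iterPartial (multiWord (Fin.cons μ ν : Fin (d + 1) → ℕ)) (condCDFJoint f)
    (Fin.cons y x : Fin (d + 1) → ℝ)

/-- `θ_{μ,ν}` exists and is continuous on `[0,1] × [0,1]^d`. -/
def ThetaExistsContinuous {d : ℕ} (f : ℝ → (Fin d → ℝ) → ℝ) (μ : ℕ) (ν : Fin d → ℕ) : Prop :=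
  IterPartialExists (multiWord (Fin.cons μ ν : Fin (d + 1) → ℕ)) (condCDFJoint f) ∧
  ContinuousOn (fun z : ℝ × (Fin d → ℝ) => theta f μ ν z.1 z.2)
    (Set.Icc (0 : ℝ) 1 ×ˢ Set.Icc (0 : Fin d → ℝ) 1)

/-! ### Assumptions -/

/-- Data generating process: `(Y i, X i)` is a random sample from a distribution on
`[0,1] × [0,1]^d` with joint Lebesgue density `f`, which is continuous and bounded away from zero
on that cube, and `θ_{2,0}` exists and is continuous. -/
structure IsDGP {Ω : Type*} [MeasurableSpace Ω] (P : Measure Ω) {d : ℕ}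
    (Y : ℕ → Ω → ℝ) (X : ℕ → Ω → Fin d → ℝ) (f : ℝ → (Fin d → ℝ) → ℝ) : Prop where
  measurable_Y : ∀ i, Measurable (Y i)
  measurable_X : ∀ i, Measurable (X i)
  indep : iIndepFun (fun i ω => (Y i ω, X i ω)) P
  law : ∀ i, P.map (fun ω => (Y i ω, X i ω)) =
    ((volume : Measure (ℝ × (Fin d → ℝ))).restrict
      (Set.Icc (0 : ℝ) 1 ×ˢ Set.Icc (0 : Fin d → ℝ) 1)).withDensity
        fun z => ENNReal.ofReal (f z.1 z.2)
  density_continuous : ContinuousOn (fun z : ℝ × (Fin d → ℝ) => f z.1 z.2)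
    (Set.Icc (0 : ℝ) 1 ×ˢ Set.Icc (0 : Fin d → ℝ) 1)
  density_lower : ∃ c : ℝ, 0 < c ∧
    ∀ y ∈ Set.Icc (0 : ℝ) 1, ∀ x ∈ Set.Icc (0 : Fin d → ℝ) 1, c ≤ f y x
  theta_two : ThetaExistsContinuous f 2 0

/-- The kernel is nonnegative, symmetric, supported on `[-1,1]`, Lipschitz continuous, and
integrates to one. -/
structure IsKernelFun (K : ℝ → ℝ) : Prop where
  nonneg : ∀ u, 0 ≤ K u
  symmetric : ∀ u, K (-u) = K u
  support : Function.support K ⊆ Set.Icc (-1) 1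
  lipschitz : ∃ C : NNReal, LipschitzWith C K
  integral_one : ∫ u, K u = 1

/-- The Lebesgue density `g = G'` on `[0,1]` of a weighting function `G` that is continuously
differentiable on `[0,1]`. -/
def weightDensity (G : ℝ → ℝ) (u : ℝ) : ℝ := derivWithin G (Set.Icc 0 1) u

/-- The Lebesgue-Stieltjes integral `∫_{[0,1]} φ(u) dG(u)`, for a weighting function `G` that is
continuously differentiable on `[0,1]`, so that `dG(u) = g(u) du` there. -/
def integralDG (G : ℝ → ℝ) (φ : ℝ → ℝ) : ℝ :=
  ∫ u in Set.Icc (0 : ℝ) 1, φ u * weightDensity G u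

/-! ### Polynomial bases and kernels -/

/-- The multi-indices `m ∈ ℕ^d` with `|m| ≤ q`. -/
def multiIdx (d q : ℕ) : Finset (Fin d → ℕ) :=
  (Fintype.piFinset fun _ => Finset.range (q + 1)).filter fun m => ∑ j, m j ≤ q

/-- The scaled monomial `v^m / m!`. -/
def mono {d : ℕ} (m : Fin d → ℕ) (v : Fin d → ℝ) : ℝ :=
  ∏ j, (v j ^ m j / ((m j).factorial : ℝ))

/-- `p(u) = (1, u, u²/2, …, u^p/p!)`. -/
def pVec (p : ℕ) (u : ℝ) : Fin (p + 1) → ℝ :=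
  fun k => u ^ (k : ℕ) / ((k : ℕ).factorial : ℝ)

/-- `q(v) = (v^m / m!)_{|m| ≤ q}`. -/
def qVec {d : ℕ} (q : ℕ) (v : Fin d → ℝ) : multiIdx d q → ℝ := fun m => mono m.1 v

/-- The product kernel `L(v) = K(v_1) ⋯ K(v_d)`. -/
def prodKernel {d : ℕ} (K : ℝ → ℝ) (v : Fin d → ℝ) : ℝ := ∏ j, K (v j)

/-- `P = p K`. -/
def PVec (K : ℝ → ℝ) (p : ℕ) (u : ℝ) : Fin (p + 1) → ℝ := fun k => pVec p u k * K u

/-- `Q = q L`. -/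
def QVec {d : ℕ} (K : ℝ → ℝ) (q : ℕ) (v : Fin d → ℝ) : multiIdx d q → ℝ :=
  fun m => qVec q v m * prodKernel K v

/-- The basis vector `e_μ` extracting the `μ`-th element of `p`. -/
def eY (p μ : ℕ) : Fin (p + 1) → ℝ := fun k => if (k : ℕ) = μ then 1 else 0

/-- The basis vector `e_ν` extracting the `ν`-th element of `q`. -/
def eX {d : ℕ} (q : ℕ) (ν : Fin d → ℕ) : multiIdx d q → ℝ := fun m => if m.1 = ν then 1 else 0

/-- `(x' - x) / h`. -/
def scaled {d : ℕ} (h : ℝ) (x x' : Fin d → ℝ) : Fin d → ℝ := fun j => (x' j - x j) / h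

/-! ### The matrices `S` and `c` -/

/-- `S_y = ∫_{([0,1]-y)/h} p(u) P(u)ᵀ g(y+hu) du`. -/
def SY (K G : ℝ → ℝ) (p : ℕ) (h y : ℝ) : Matrix (Fin (p + 1)) (Fin (p + 1)) ℝ :=
  Matrix.of fun a b => ∫ u in {u : ℝ | y + h * u ∈ Set.Icc (0 : ℝ) 1},
    pVec p u a * PVec K p u b * weightDensity G (y + h * u)

/-- `c_{y,ℓ} = ∫_{([0,1]-y)/h} (u^ℓ/ℓ!) P(u) g(y+hu) du`. -/
def cY (K G : ℝ → ℝ) (p ℓ : ℕ) (h y : ℝ) : Fin (p + 1) → ℝ :=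
  fun a => ∫ u in {u : ℝ | y + h * u ∈ Set.Icc (0 : ℝ) 1},
    u ^ ℓ / (ℓ.factorial : ℝ) * PVec K p u a * weightDensity G (y + h * u)

/-- `S_x = ∫_{([0,1]^d-x)/h} q(v) Q(v)ᵀ f_x(x+hv) dv`. -/
def SX {d : ℕ} (K : ℝ → ℝ) (f : ℝ → (Fin d → ℝ) → ℝ) (q : ℕ) (h : ℝ) (x : Fin d → ℝ) :
    Matrix (multiIdx d q) (multiIdx d q) ℝ :=
  Matrix.of fun a b => ∫ v in {v : Fin d → ℝ | x + h • v ∈ Set.Icc (0 : Fin d → ℝ) 1},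
    qVec q v a * QVec K q v b * marginalX f (x + h • v)

/-- `c_{x,m} = ∫_{([0,1]^d-x)/h} (v^m/m!) Q(v) f_x(x+hv) dv`. -/
def cX {d : ℕ} (K : ℝ → ℝ) (f : ℝ → (Fin d → ℝ) → ℝ) (q : ℕ) (m : Fin d → ℕ) (h : ℝ)
    (x : Fin d → ℝ) : multiIdx d q → ℝ :=
  fun a => ∫ v in {v : Fin d → ℝ | x + h • v ∈ Set.Icc (0 : Fin d → ℝ) 1},
    mono m v * QVec K q v a * marginalX f (x + h • v)

/-- `Ŝ_y = (nh)⁻¹ ∑_{i ≤ n} p((y_i-y)/h) P((y_i-y)/h)ᵀ` for the data `ys`. -/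
def SYhat (K : ℝ → ℝ) (p n : ℕ) (ys : ℕ → ℝ) (h y : ℝ) :
    Matrix (Fin (p + 1)) (Fin (p + 1)) ℝ :=
  Matrix.of fun a b => 1 / ((n : ℝ) * h) *
    ∑ i ∈ Finset.range n, pVec p ((ys i - y) / h) a * PVec K p ((ys i - y) / h) b

/-- `Ŝ_x = (nh^d)⁻¹ ∑_{i ≤ n} q((x_i-x)/h) Q((x_i-x)/h)ᵀ` for the data `xs`. -/
def SXhat {d : ℕ} (K : ℝ → ℝ) (q n : ℕ) (xs : ℕ → Fin d → ℝ) (h : ℝ) (x : Fin d → ℝ) :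
    Matrix (multiIdx d q) (multiIdx d q) ℝ :=
  Matrix.of fun a b => 1 / ((n : ℝ) * h ^ d) *
    ∑ i ∈ Finset.range n, qVec q (scaled h x (xs i)) a * QVec K q (scaled h x (xs i)) b

/-! ### Conditional-mean parts of the two estimators, and the leading bias -/

/-- The bracketed matrix for the estimator with local smoothing,
`(n h^{μ+|ν|})⁻¹ ∑_i (∫ F(u|x_i) h⁻¹ P((u-y)/h) dG(u)) h^{-d} Q((x_i-x)/h)ᵀ`. -/
def RbarMean {d : ℕ} (K G : ℝ → ℝ) (f : ℝ → (Fin d → ℝ) → ℝ) (p q μ : ℕ) (ν : Fin d → ℕ)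
    (n : ℕ) (xs : ℕ → Fin d → ℝ) (h y : ℝ) (x : Fin d → ℝ) :
    Matrix (Fin (p + 1)) (multiIdx d q) ℝ :=
  Matrix.of fun a m => 1 / ((n : ℝ) * h ^ (μ + ∑ j, ν j)) *
    ∑ i ∈ Finset.range n,
      integralDG G (fun u => condCDF f u (xs i) * (1 / h * PVec K p ((u - y) / h) a)) *
        (1 / h ^ d * QVec K q (scaled h x (xs i)) m)

/-- The bracketed matrix for the estimator by local regression,
`(n² h^{μ+|ν|})⁻¹ ∑_i ∑_j F(y_j|x_i) h⁻¹ P((y_j-y)/h) h^{-d} Q((x_i-x)/h)ᵀ`. -/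
def RhatMean {d : ℕ} (K : ℝ → ℝ) (f : ℝ → (Fin d → ℝ) → ℝ) (p q μ : ℕ) (ν : Fin d → ℕ)
    (n : ℕ) (ys : ℕ → ℝ) (xs : ℕ → Fin d → ℝ) (h y : ℝ) (x : Fin d → ℝ) :
    Matrix (Fin (p + 1)) (multiIdx d q) ℝ :=
  Matrix.of fun a m => 1 / ((n : ℝ) ^ 2 * h ^ (μ + ∑ j, ν j)) *
    ∑ i ∈ Finset.range n, ∑ j ∈ Finset.range n,
      condCDF f (ys j) (xs i) * (1 / h * PVec K p ((ys j - y) / h) a) *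
        (1 / h ^ d * QVec K q (scaled h x (xs i)) m)

/-- `e_μᵀ S_y⁻¹ [RbarMean] Ŝ_x⁻¹ e_ν`. -/
def meanCheck {d : ℕ} (K G : ℝ → ℝ) (f : ℝ → (Fin d → ℝ) → ℝ) (p q μ : ℕ) (ν : Fin d → ℕ)
    (n : ℕ) (xs : ℕ → Fin d → ℝ) (h y : ℝ) (x : Fin d → ℝ) : ℝ :=
  eY p μ ⬝ᵥ ((SY K G p h y)⁻¹ * RbarMean K G f p q μ ν n xs h y x *
    (SXhat K q n xs h x)⁻¹).mulVec (eX q ν)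

/-- `e_μᵀ Ŝ_y⁻¹ [RhatMean] Ŝ_x⁻¹ e_ν`. -/
def meanHat {d : ℕ} (K : ℝ → ℝ) (f : ℝ → (Fin d → ℝ) → ℝ) (p q μ : ℕ) (ν : Fin d → ℕ)
    (n : ℕ) (ys : ℕ → ℝ) (xs : ℕ → Fin d → ℝ) (h y : ℝ) (x : Fin d → ℝ) : ℝ :=
  eY p μ ⬝ᵥ ((SYhat K p n ys h y)⁻¹ * RhatMean K f p q μ ν n ys xs h y x *
    (SXhat K q n xs h x)⁻¹).mulVec (eX q ν)

/-- The leading bias `B_{μ,ν}(y, x)`. -/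
def leadingBias {d : ℕ} (K G : ℝ → ℝ) (f : ℝ → (Fin d → ℝ) → ℝ) (p q μ : ℕ) (ν : Fin d → ℕ)
    (h y : ℝ) (x : Fin d → ℝ) : ℝ :=
  h ^ (q + 1 - ∑ j, ν j) *
      (∑ m ∈ multiIdx d (q + 1) with ∑ j, m j = q + 1,
        theta f μ m y x * (cX K f q m h x ⬝ᵥ (SX K f q h x)⁻¹.mulVec (eX q ν))) +
    h ^ (p + 1 - μ) *
      (theta f (p + 1) ν y x * (cY K G p (p + 1) h y ⬝ᵥ (SY K G p h y)⁻¹.mulVec (eY p μ)))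

/-- The order of the bias, `h^{q+1-|ν|} + h^{p+1-μ}`. -/
def biasRate {d : ℕ} (p q μ : ℕ) (ν : Fin d → ℕ) (h : ℝ) : ℝ :=
  h ^ (q + 1 - ∑ j, ν j) + h ^ (p + 1 - μ)

end

end CondDist

/-! Put M = max(q + 1 + μ, p + 1 + |ν|). Each bracket averages F(s | w) over s near y and w near x.
Taylor's formula of order M at (y, x) replaces F by the sum over k + |m| ≤ M of h^(k+|m|) θ_{k,m}
(u^k/k!) (v^m/m!), where u and v are the rescaled increments, with an error o(h^M) uniform over the
kernel window. Monomials separate the two variables. So h^(μ+|ν|) times the bracket is, up to that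
error, a sum of rank-one matrices h^(k+|m|) θ_{k,m} c_{y,k} c_{x,m}ᵀ with population or sample
moments c. In particular the double sum of the second estimator becomes a product of single sums,
and its diagonal needs no separate treatment.

Sandwiching a rank-one term gives α_k β_m, with α_k = e_μᵀ S_y⁻¹ c_{y,k} and β_m = c_{x,m}ᵀ S_x⁻¹
e_ν. For k ≤ p the vector c_{y,k} is a column of the same S_y, so α_k = 1{k = μ} exactly; likewise
β_m = 1{m = ν} for |m| ≤ q. Of the low-order terms only θ_{μ,ν} survives. The next ones are (μ, m)
with |m| = q + 1 and (p + 1, ν), the two parts of the bias; all others carry a higher power of h.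
This bookkeeping is `tendsto_bias_expansion`, and `tendsto_sandwich_bias` adds the matrix algebra.

In the bias, sample coefficients may be replaced by population ones because both have the same
limit. Moments converge to the density at the point times a moment over the tangent cone of the cube
(`tendsto_setIntegral_rescaled`, and `tendstoInMeasure_kernel_average` for samples). The limiting
Gram matrices are invertible (`det_gram_ne_zero`), and the density factor cancels in S⁻¹c. Hence
g(y) in the first estimator and the density of y_i in the second lead to the same bias.

Randomness enters only through finitely many kernel moments. `tendstoInMeasure_of_statistics`
reduces the claim to a deterministic limit along a filter on ℕ × Ω. The Taylor formula,
`taylor_cube`, holds up to the boundary and uses the partial derivatives only in the order in which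
θ is defined. -/

namespace CondDist

/-! ### Localization at a point of a closed set, and Gram matrices. -/

section Rescaling

variable {E : Type*} [NormedAddCommGroup E] [NormedSpace ℝ E] [FiniteDimensional ℝ E]
  [MeasurableSpace E] [BorelSpace E] (vol : Measure E) [vol.IsAddHaarMeasure]

/-- The substitution `s = x + h v`. -/
theorem setIntegral_eq_rescaled {C : Set E} (hC : MeasurableSet C) (F : E → ℝ) (x : E) {h : ℝ}
    (hh : 0 < h) :
    ∫ s in C, F s ∂vol =
      h ^ Module.finrank ℝ E * ∫ v in {v : E | x + h • v ∈ C}, F (x + h • v) ∂vol := by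
  have hm : MeasurableSet {v : E | x + h • v ∈ C} :=
    (show Measurable fun v : E => x + h • v by fun_prop) hC
  rw [← integral_indicator hC, ← integral_indicator hm]
  have h1 := Measure.integral_comp_smul vol (fun v => C.indicator F (x + v)) h
  rw [integral_add_left_eq_self (μ := vol) (fun v => C.indicator F v) x] at h1
  have h2 : ({v : E | x + h • v ∈ C}.indicator fun v => F (x + h • v)) =
      fun v => C.indicator F (x + h • v) := by
    ext v; simp [Set.indicator]
  rw [h2, h1, abs_of_pos (by positivity), smul_eq_mul, ← mul_assoc,
    mul_inv_cancel₀ (by positivity), one_mul]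

omit [FiniteDimensional ℝ E] in
/-- Localization of an integral over a shrinking neighbourhood of `x`, relative to a closed set `C`
with tangent cone `D` at `x`. -/
theorem tendsto_setIntegral_rescaled {C D : Set E} (hC : IsCompact C) (hD : MeasurableSet D) {x : E}
    (hx : x ∈ C) (hCD : ∀ v, ∀ᶠ h in 𝓝[>] (0 : ℝ), (x + h • v ∈ C ↔ v ∈ D))
    {w : E → ℝ} (hw : ContinuousOn w C) {φ : E → ℝ} (hφ : Continuous φ)
    (hφs : HasCompactSupport φ) :
    Tendsto (fun h : ℝ => ∫ v in {v : E | x + h • v ∈ C}, φ v * w (x + h • v) ∂vol) (𝓝[>] 0)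
      (𝓝 (w x * ∫ v in D, φ v ∂vol)) := by
  obtain ⟨B, hB⟩ := hC.exists_bound_of_continuousOn hw
  have hcl : ∀ h : ℝ, MeasurableSet {v : E | x + h • v ∈ C} := fun h =>
    (show Measurable fun v : E => x + h • v by fun_prop) hC.measurableSet
  have e1 : ∀ h : ℝ, ∫ v in {v : E | x + h • v ∈ C}, φ v * w (x + h • v) ∂vol =
      ∫ v, {v : E | x + h • v ∈ C}.indicator (fun v => φ v * w (x + h • v)) v ∂vol := fun h =>
    (integral_indicator (hcl h)).symm
  have e2 : w x * ∫ v in D, φ v ∂vol = ∫ v, D.indicator (fun v => φ v * w x) v ∂vol := by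
    rw [integral_indicator hD, ← integral_const_mul]
    simp_rw [mul_comm]
  simp_rw [e1]
  rw [e2]
  -- Needed off the set, where the integrand is 0 and must still lie below |φ| B.
  have hBn : 0 ≤ B := (norm_nonneg _).trans (hB x hx)
  refine tendsto_integral_filter_of_dominated_convergence (fun v => |φ v| * B) ?_ ?_ ?_ ?_
  · refine Eventually.of_forall fun h => ?_
    rw [aestronglyMeasurable_indicator_iff (hcl h)]
    refine ContinuousOn.aestronglyMeasurable ?_ (hcl h)
    exact hφ.continuousOn.mul (hw.comp (by fun_prop) fun v hv => hv)
  · refine Eventually.of_forall fun h => Eventually.of_forall fun v => ?_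
    by_cases hv : x + h • v ∈ C
    · rw [Set.indicator_of_mem (by exact hv), norm_mul]
      exact mul_le_mul_of_nonneg_left (hB _ hv) (norm_nonneg _)
    · rw [Set.indicator_of_notMem (by exact hv), norm_zero]
      positivity
  · exact ((hφ.integrable_of_hasCompactSupport hφs).abs).mul_const B
  · refine Eventually.of_forall fun v => ?_
    by_cases hv : v ∈ D
    · have hin : ∀ᶠ h in 𝓝[>] (0 : ℝ), x + h • v ∈ C := (hCD v).mono fun h hh => hh.2 hv
      have ht : Tendsto (fun h : ℝ => x + h • v) (𝓝[>] 0) (𝓝[C] x) := by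
        refine tendsto_nhdsWithin_iff.2 ⟨?_, hin⟩
        have : Continuous fun h : ℝ => x + h • v := by fun_prop
        exact (this.tendsto' 0 x (by simp)).mono_left nhdsWithin_le_nhds
      rw [Set.indicator_of_mem hv]
      refine Tendsto.congr' (f₁ := fun h => φ v * w (x + h • v)) ?_
        (((hw x hx).tendsto.comp ht).const_mul _)
      filter_upwards [hin] with h hh
      rw [Set.indicator_of_mem (by exact hh)]
    · rw [Set.indicator_of_notMem hv]
      refine Tendsto.congr' ?_ tendsto_const_nhds
      filter_upwards [hCD v] with h hh
      rw [Set.indicator_of_notMem]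
      exact fun hc => hv (hh.1 hc)

omit [NormedSpace ℝ E] [FiniteDimensional ℝ E] in
/-- The Gram matrix of locally linearly independent functions is invertible. -/
theorem det_gram_ne_zero {κ : Type*} [Fintype κ] [DecidableEq κ] {D : Set E}
    {b : κ → E → ℝ} (hb : ∀ a, Continuous (b a)) {ω : E → ℝ} (hω : Continuous ω)
    (hωs : HasCompactSupport ω) (hω0 : ∀ v, 0 ≤ ω v) {v₀ : E}
    (hv₀ : ∀ᶠ v in 𝓝 v₀, v ∈ D ∧ 0 < ω v)
    (hlin : ∀ c : κ → ℝ, (∀ᶠ v in 𝓝 v₀, ∑ a, c a * b a v = 0) → c = 0) :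
    (Matrix.of fun a a' => ∫ v in D, b a v * (b a' v * ω v) ∂vol).det ≠ 0 := by
  intro hdet
  obtain ⟨c, hc, hc0⟩ := Matrix.exists_mulVec_eq_zero_iff.2 hdet
  refine hc (hlin c ?_)
  have hint : ∀ ψ : E → ℝ, Continuous ψ → Integrable (fun v => ψ v * ω v) (vol.restrict D) :=
    fun ψ hψ => ((hψ.mul hω).integrable_of_hasCompactSupport hωs.mul_left).restrict
  have hs : Continuous fun v => ∑ a, c a * b a v :=
    continuous_finsetSum _ fun a _ => (hb a).const_mul (c a)
  -- The quadratic form of the Gram matrix at a kernel vector `c` is the weighted L² norm of the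
  -- combination with coefficients `c`.
  have hsq : ∫ v in D, (∑ a, c a * b a v) ^ 2 * ω v ∂vol = 0 := by
    have h1 : ∑ a, c a * ∑ a', (∫ v in D, b a v * (b a' v * ω v) ∂vol) * c a' = 0 := by
      refine Finset.sum_eq_zero fun a _ => ?_
      have := congrFun hc0 a
      simp only [Matrix.mulVec, dotProduct, Matrix.of_apply, Pi.zero_apply] at this
      rw [this, mul_zero]
    rw [← h1]
    have h2 : ∀ a a', ∫ v in D, b a v * (b a' v * ω v) ∂vol =
        ∫ v in D, (b a v * b a' v) * ω v ∂vol := fun a a' => by simp_rw [mul_assoc]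
    have h3 : ∀ v, (∑ a, c a * b a v) ^ 2 * ω v =
        ∑ a, c a * ∑ a', (b a v * b a' v * ω v) * c a' := fun v => by
      rw [sq, Finset.sum_mul_sum, Finset.sum_mul]
      refine Finset.sum_congr rfl fun a _ => ?_
      rw [Finset.sum_mul, Finset.mul_sum]
      exact Finset.sum_congr rfl fun a' _ => by ring
    have hi : ∀ a a', Integrable (fun v => b a v * b a' v * ω v * c a') (vol.restrict D) :=
      fun a a' => (hint _ ((hb a).mul (hb a'))).mul_const _
    simp_rw [h3, h2]
    rw [integral_finsetSum _ fun a _ => (integrable_finsetSum _ fun a' _ => hi a a').const_mul _]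
    refine Finset.sum_congr rfl fun a _ => ?_
    rw [integral_const_mul, integral_finsetSum _ fun a' _ => hi a a']
    simp_rw [integral_mul_const]
  rw [integral_eq_zero_iff_of_nonneg (fun v => mul_nonneg (sq_nonneg _) (hω0 v))
    (hint _ (hs.pow 2))] at hsq
  obtain ⟨U, hU, hUo, hvU⟩ := eventually_nhds_iff.1 hv₀
  have hUD : U ⊆ D := fun v hv => (hU v hv).1
  -- Continuity upgrades almost everywhere vanishing to vanishing at every point of the open set
  -- `U`, where the weight is positive.
  have h3 := Measure.eqOn_open_of_ae_eq (ae_restrict_of_ae_restrict_of_subset hUD hsq) hUo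
    (((hs.pow 2).mul hω).continuousOn) continuousOn_const
  filter_upwards [hUo.mem_nhds hvU] with v hv
  have h4 : (∑ a, c a * b a v) ^ 2 * ω v = 0 := h3 hv
  exact pow_eq_zero_iff two_ne_zero |>.1 ((mul_eq_zero.1 h4).resolve_right (hU v hv).2.ne')

end Rescaling

/-! ### Monomials are linearly independent on open sets. -/

theorem eq_zero_of_eventually_pVec {p : ℕ} {v₀ : ℝ} {c : Fin (p + 1) → ℝ}
    (hc : ∀ᶠ v in 𝓝 v₀, ∑ a, c a * pVec p v a = 0) : c = 0 := by
  obtain ⟨ε, hε, hball⟩ := Metric.eventually_nhds_iff_ball.1 hc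
  set Q : Polynomial ℝ := ∑ a : Fin (p + 1),
    Polynomial.monomial (a : ℕ) (c a / ((a : ℕ).factorial : ℝ)) with hQ
  have hQ0 : Q = 0 := by
    refine Polynomial.eq_of_infinite_eval_eq _ _ (Set.Infinite.mono (s := Metric.ball v₀ ε) ?_ ?_)
    · intro v hv
      simp only [Set.mem_ofPred_eq, Polynomial.eval_zero, hQ, Polynomial.eval_finsetSum,
        Polynomial.eval_monomial]
      rw [← hball v hv]
      exact Finset.sum_congr rfl fun a _ => by simp only [pVec]; ring
    · rw [Real.ball_eq_Ioo]
      exact Set.Ioo_infinite (by linarith)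
  ext a
  have h1 : Q.coeff a = c a / ((a : ℕ).factorial : ℝ) := by
    rw [hQ, Polynomial.finsetSum_coeff, Finset.sum_eq_single a]
    · simp
    · intro b _ hb
      rw [Polynomial.coeff_monomial, if_neg fun h => hb (Fin.ext h)]
    · simp
  rw [hQ0, Polynomial.coeff_zero, eq_comm, div_eq_zero_iff] at h1
  exact h1.resolve_right (by positivity)

/-- A sup-norm ball is a product of intervals, hence of infinite sets, and a multivariate polynomial
vanishing on such a product is zero. Division by the factorials does not affect which coefficients
vanish. -/
theorem eq_zero_of_eventually_qVec {d q : ℕ} {v₀ : Fin d → ℝ} {c : multiIdx d q → ℝ}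
    (hc : ∀ᶠ v in 𝓝 v₀, ∑ a, c a * qVec q v a = 0) : c = 0 := by
  obtain ⟨ε, hε, hball⟩ := Metric.eventually_nhds_iff_ball.1 hc
  set Q : MvPolynomial (Fin d) ℝ := ∑ a : multiIdx d q,
    MvPolynomial.monomial (Finsupp.equivFunOnFinite.symm a.1)
      (c a / ∏ j, ((a.1 j).factorial : ℝ)) with hQ
  have hQ0 : Q = 0 := by
    refine MvPolynomial.funext_set (fun j => Metric.ball (v₀ j) ε) (fun j => ?_) fun v hv => ?_
    · rw [Real.ball_eq_Ioo]
      exact Set.Ioo_infinite (by linarith)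
    · have hv' : v ∈ Metric.ball v₀ ε := by
        rw [ball_pi _ hε]; exact hv
      rw [map_zero, hQ, map_sum, ← hball v hv']
      refine Finset.sum_congr rfl fun a _ => ?_
      rw [MvPolynomial.eval_monomial, Finsupp.prod_fintype _ _ (by simp)]
      simp only [qVec, mono, Finsupp.equivFunOnFinite_symm_apply_apply, Finset.prod_div_distrib]
      ring
  ext a
  have h1 : Q.coeff (Finsupp.equivFunOnFinite.symm a.1) = c a / ∏ j, ((a.1 j).factorial : ℝ) := by
    rw [hQ, MvPolynomial.coeff_sum, Finset.sum_eq_single a]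
    · simp
    · intro b _ hb
      rw [MvPolynomial.coeff_monomial, if_neg]
      exact fun h => hb (Subtype.ext (Finsupp.equivFunOnFinite.symm.injective h))
    · simp
  rw [hQ0, MvPolynomial.coeff_zero, eq_comm, div_eq_zero_iff] at h1
  exact h1.resolve_right (by positivity)

/-! ### Taylor's formula on the closed cube. -/

/-- One-variable Taylor estimate for a chain of successive derivatives on `[0,1]`. -/
theorem taylor_chain_estimate {L : ℕ} {φ : ℕ → ℝ → ℝ}
    (hφ : ∀ l < L, ∀ t ∈ Set.Icc (0 : ℝ) 1,
      HasDerivWithinAt (φ l) (φ (l + 1) t) (Set.Icc 0 1) t)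
    {a s c ε : ℝ} (ha : a ∈ Set.Icc (0 : ℝ) 1) (hs : s ∈ Set.Icc (0 : ℝ) 1)
    (hc : ∀ t ∈ Set.uIcc a s, |φ L t - c| ≤ ε) :
    |φ 0 s - (∑ l ∈ Finset.range L, φ l a * ((s - a) ^ l / (l.factorial : ℝ)) +
      c * ((s - a) ^ L / (L.factorial : ℝ)))| ≤ ε * |s - a| ^ L := by
  induction L generalizing φ s with
  | zero => simpa using hc s Set.right_mem_uIcc
  | succ L ih =>
    have hsub : Set.uIcc a s ⊆ Set.Icc (0 : ℝ) 1 := (convex_Icc 0 1).ordConnected.uIcc_subset ha hs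
    have hε : 0 ≤ ε := (abs_nonneg _).trans (hc s Set.right_mem_uIcc)
    -- The remainder as a function of its endpoint. Its derivative is the remainder of the shifted
    -- chain, bounded by the induction hypothesis; the mean value inequality then supplies the extra
    -- factor |s - a|.
    set ρ : ℝ → ℝ := fun t => φ 0 t -
      (∑ l ∈ Finset.range (L + 1), φ l a * ((t - a) ^ l / (l.factorial : ℝ)) +
        c * ((t - a) ^ (L + 1) / ((L + 1).factorial : ℝ))) with hρ
    have hpow : ∀ (l : ℕ) (t : ℝ), HasDerivAt (fun t : ℝ => (t - a) ^ (l + 1) /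
        ((l + 1).factorial : ℝ)) ((t - a) ^ l / (l.factorial : ℝ)) t := by
      intro l t
      have h := ((((hasDerivAt_id t).sub_const a).pow (l + 1)).div_const ((l + 1).factorial : ℝ))
      refine h.congr_deriv ?_
      rw [Nat.factorial_succ]
      simp only [id, Nat.cast_mul, Nat.cast_succ, Nat.add_sub_cancel]
      field_simp
    have hder : ∀ t ∈ Set.uIcc a s, HasDerivWithinAt ρ (φ 1 t -
        (∑ l ∈ Finset.range L, φ (l + 1) a * ((t - a) ^ l / (l.factorial : ℝ)) +
          c * ((t - a) ^ L / (L.factorial : ℝ)))) (Set.uIcc a s) t := by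
      intro t ht
      have h0 := (hφ 0 (Nat.succ_pos _) t (hsub ht)).mono hsub
      have h1 : HasDerivAt (fun t : ℝ =>
          ∑ l ∈ Finset.range (L + 1), φ l a * ((t - a) ^ l / (l.factorial : ℝ)))
          (∑ l ∈ Finset.range L, φ (l + 1) a * ((t - a) ^ l / (l.factorial : ℝ))) t := by
        simp_rw [Finset.sum_range_succ' _ L]
        simp only [pow_zero, Nat.factorial_zero]
        refine HasDerivAt.add_const _ ?_
        have := HasDerivAt.sum (u := Finset.range L) (x := t) fun l _ => (hpow l t).const_mul (φ (l + 1) a)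
        convert this using 1
        ext z; simp
      exact h0.sub (h1.add ((hpow L t).const_mul c)).hasDerivWithinAt
    have hbd : ∀ t ∈ Set.uIcc a s, ‖φ 1 t -
        (∑ l ∈ Finset.range L, φ (l + 1) a * ((t - a) ^ l / (l.factorial : ℝ)) +
          c * ((t - a) ^ L / (L.factorial : ℝ)))‖ ≤ ε * |s - a| ^ L := by
      intro t ht
      have h1 := ih (φ := fun l => φ (l + 1)) (s := t)
        (fun l hl z hz => hφ (l + 1) (by omega) z hz) (hsub ht)
        (fun z hz => hc z (Set.uIcc_subset_uIcc_left ht hz))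
      refine h1.trans (mul_le_mul_of_nonneg_left (pow_le_pow_left₀ (abs_nonneg _) ?_ _) hε)
      exact Set.abs_sub_left_of_mem_uIcc ht
    have := (convex_uIcc a s).norm_image_sub_le_of_norm_hasDerivWithin_le hder hbd
      Set.left_mem_uIcc Set.right_mem_uIcc
    have ha0 : ρ a = 0 := by
      simp [hρ, Finset.sum_range_succ' _ L]
    rw [ha0, sub_zero] at this
    rw [pow_succ |s - a|, ← mul_assoc]
    exact this

variable {N : ℕ}

theorem iterPartial_append (w w' : List (Fin N)) (Φ : (Fin N → ℝ) → ℝ) :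
    iterPartial (w ++ w') Φ = iterPartial w (iterPartial w' Φ) := by
  induction w with
  | nil => rfl
  | cons i w ih => simp [iterPartial, ih]

/-- Existence of a long word includes existence of its suffixes. This is how derivatives of order
below `L` are obtained from those of order `L`. -/
theorem iterPartialExists_append {w w' : List (Fin N)} {Φ : (Fin N → ℝ) → ℝ} :
    IterPartialExists (w ++ w') Φ ↔
      IterPartialExists w' Φ ∧ IterPartialExists w (iterPartial w' Φ) := by
  induction w with
  | nil => simp [IterPartialExists]
  | cons i w ih =>
    simp only [List.cons_append, IterPartialExists, ih, iterPartial_append]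
    tauto

/-- The word in which each `i` of the list `cs` occurs `m i` times. -/
def expWord (cs : List (Fin N)) (m : Fin N → ℕ) : List (Fin N) :=
  cs.flatMap fun i => List.replicate (m i) i

/-- The last coordinate of the list forms the innermost block, so its derivatives are taken first.
This dictates the order of the induction in `taylor_expSet`. -/
theorem expWord_update {cs : List (Fin N)} {i : Fin N} (hi : i ∉ cs) (m : Fin N → ℕ) (k : ℕ) :
    expWord (cs ++ [i]) (Function.update m i k) = expWord cs m ++ List.replicate k i := by
  simp only [expWord, List.flatMap_append, List.flatMap_singleton, Function.update_self]
  congr 1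
  refine List.flatMap_congr fun j hj => ?_
  rw [Function.update_of_ne (by rintro rfl; exact hi hj)]

/-- Exponents of total degree at most `L` supported on the list `cs`. -/
def expSet (cs : List (Fin N)) (L : ℕ) : Finset (Fin N → ℕ) :=
  (multiIdx N L).filter fun m => ∀ j, j ∉ cs → m j = 0

theorem mem_multiIdx {L : ℕ} {m : Fin N → ℕ} : m ∈ multiIdx N L ↔ ∑ j, m j ≤ L := by
  simp only [multiIdx, Finset.mem_filter, Fintype.mem_piFinset, Finset.mem_range,
    and_iff_right_iff_imp]
  intro h j
  have := Finset.single_le_sum (f := m) (fun _ _ => Nat.zero_le _) (Finset.mem_univ j)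
  omega

theorem mem_expSet {cs : List (Fin N)} {L : ℕ} {m : Fin N → ℕ} :
    m ∈ expSet cs L ↔ ∑ j, m j ≤ L ∧ ∀ j, j ∉ cs → m j = 0 := by
  rw [expSet, Finset.mem_filter, mem_multiIdx]

theorem sum_update_add (m : Fin N → ℕ) (i : Fin N) (k : ℕ) (hi : m i = 0) :
    ∑ j, Function.update m i k j = k + ∑ j, m j := by
  rw [Finset.sum_update_of_mem (Finset.mem_univ i), ← Finset.sum_sdiff (Finset.subset_univ {i})]
  simp [hi]

/-- Exponents are sorted by their entry k at the new coordinate; the others then have total degree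
at most L - k. -/
theorem sum_expSet_append {cs : List (Fin N)} {i : Fin N} (hi : i ∉ cs) (L : ℕ)
    (T : (Fin N → ℕ) → ℝ) :
    ∑ m ∈ expSet (cs ++ [i]) L, T m =
      ∑ k ∈ Finset.range (L + 1), ∑ m ∈ expSet cs (L - k), T (Function.update m i k) := by
  rw [Finset.sum_sigma']
  symm
  refine Finset.sum_bij' (fun s _ => Function.update s.2 i s.1)
    (fun m _ => ⟨m i, Function.update m i 0⟩) ?_ ?_ ?_ ?_ ?_
  · rintro ⟨k, m⟩ hm
    simp only [Finset.mem_sigma, Finset.mem_range, mem_expSet] at hm ⊢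
    refine ⟨?_, fun j hj => ?_⟩
    · rw [sum_update_add _ _ _ (hm.2.2 i hi)]; omega
    · simp only [List.mem_append, List.mem_singleton, not_or] at hj
      rw [Function.update_of_ne hj.2, hm.2.2 j hj.1]
  · intro m hm
    simp only [Finset.mem_sigma, Finset.mem_range, mem_expSet] at hm ⊢
    have h1 := sum_update_add (Function.update m i 0) i (m i) (by simp)
    simp only [Function.update_idem, Function.update_eq_self] at h1
    refine ⟨by omega, by omega, fun j hj => ?_⟩
    by_cases hji : j = i
    · simp [hji]
    · rw [Function.update_of_ne hji]
      exact hm.2 j (by simp [hj, hji])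
  · rintro ⟨k, m⟩ hm
    simp only [Finset.mem_sigma, mem_expSet] at hm
    have : Function.update m i 0 = m := by
      rw [← hm.2.2 i hi, Function.update_eq_self]
    simp [this]
  · intro m _
    simp
  · intros; rfl

theorem mono_update {m : Fin N → ℕ} {i : Fin N} (hi : m i = 0) (k : ℕ) (v : Fin N → ℝ) :
    mono (Function.update m i k) v = v i ^ k / (k.factorial : ℝ) * mono m v := by
  unfold mono
  rw [← Finset.mul_prod_erase _ _ (Finset.mem_univ i),
    ← Finset.mul_prod_erase _ (fun j => v j ^ m j / ((m j).factorial : ℝ)) (Finset.mem_univ i)]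
  simp only [Function.update_self, hi, pow_zero, Nat.factorial_zero, Nat.cast_one, div_one, one_mul]
  congr 1
  refine Finset.prod_congr rfl fun j hj => ?_
  rw [Function.update_of_ne (Finset.ne_of_mem_erase hj)]

theorem iterPartial_replicate_succ (k : ℕ) (i : Fin N) (Φ : (Fin N → ℝ) → ℝ) :
    iterPartial (List.replicate (k + 1) i) Φ =
      cubePartial i (iterPartial (List.replicate k i) Φ) := rfl

theorem update_mem_cube {z : Fin N → ℝ} (hz : z ∈ Set.Icc (0 : Fin N → ℝ) 1) (i : Fin N) {t : ℝ}
    (ht : t ∈ Set.Icc (0 : ℝ) 1) : Function.update z i t ∈ Set.Icc (0 : Fin N → ℝ) 1 := by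
  constructor <;> intro j <;> by_cases hj : j = i
  · subst hj; simpa using ht.1
  · simpa [Function.update_of_ne hj] using hz.1 j
  · subst hj; simpa using ht.2
  · simpa [Function.update_of_ne hj] using hz.2 j

theorem hasDerivWithinAt_replicate {L : ℕ} {i : Fin N} {Φ : (Fin N → ℝ) → ℝ}
    (hex : IterPartialExists (List.replicate L i) Φ) {z : Fin N → ℝ}
    (hz : z ∈ Set.Icc (0 : Fin N → ℝ) 1) {l : ℕ} (hl : l < L) {t : ℝ}
    (ht : t ∈ Set.Icc (0 : ℝ) 1) :
    HasDerivWithinAt (fun t => iterPartial (List.replicate l i) Φ (Function.update z i t))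
      (iterPartial (List.replicate (l + 1) i) Φ (Function.update z i t)) (Set.Icc 0 1) t := by
  have h1 : IterPartialExists (List.replicate (l + 1) i) Φ := by
    have : List.replicate L i = List.replicate (L - (l + 1)) i ++ List.replicate (l + 1) i := by
      rw [← List.replicate_add]; congr 1; omega
    rw [this, iterPartialExists_append] at hex
    exact hex.1
  have h2 := h1.2 _ (update_mem_cube hz i ht)
  simp only [Function.update_idem, Function.update_self] at h2
  have h3 := h2.hasDerivWithinAt
  rw [iterPartial_replicate_succ]
  simpa only [cubePartial, Function.update_idem, Function.update_self] using h3

/-- Taylor expansion at `a` in the coordinates listed in `cs`, the last one first. -/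
theorem taylor_expSet {a : Fin N → ℝ} (ha : a ∈ Set.Icc (0 : Fin N → ℝ) 1) :
    ∀ (cs : List (Fin N)), cs.Nodup → ∀ (L : ℕ) (Φ : (Fin N → ℝ) → ℝ),
      (∀ m : Fin N → ℕ, (∀ j, j ∉ cs → m j = 0) → ∑ j, m j = L →
        IterPartialExists (expWord cs m) Φ ∧
          ContinuousWithinAt (iterPartial (expWord cs m) Φ) (Set.Icc 0 1) a) →
      ∀ ε > 0, ∃ δ > 0, ∀ z ∈ Set.Icc (0 : Fin N → ℝ) 1, (∀ j, j ∉ cs → z j = a j) →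
        ‖z - a‖ ≤ δ →
          |Φ z - ∑ m ∈ expSet cs L, iterPartial (expWord cs m) Φ a * mono m (z - a)| ≤
            ε * ‖z - a‖ ^ L := by
  intro cs
  induction cs using List.reverseRecOn with
  | nil =>
    intro _ L Φ _ ε hε
    refine ⟨1, one_pos, fun z _ hza _ => ?_⟩
    have hz : z = a := funext fun j => hza j (by simp)
    have hset : expSet ([] : List (Fin N)) L = {0} := by
      ext m
      simp only [mem_expSet, Finset.mem_singleton, List.not_mem_nil, not_false_eq_true, true_imp_iff]
      constructor
      · exact fun h => funext h.2
      · rintro rfl; simp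
    rw [hset, hz]
    simp [expWord, iterPartial, mono]
    positivity
  | append_singleton cs i ih =>
    intro hnd L Φ hΦ ε hε
    have hi : i ∉ cs := by
      intro h
      have := List.nodup_append.1 hnd
      exact this.2.2 _ h _ (by simp) rfl
    have hcs : cs.Nodup := (List.nodup_append.1 hnd).1
    -- Each word of order `L` splits into k derivatives in `i`, then L - k in the other coordinates:
    -- exactly the hypothesis of the induction for the k-th derivative in `i`.
    have hrep : ∀ k ≤ L, ∀ m : Fin N → ℕ, (∀ j, j ∉ cs → m j = 0) → ∑ j, m j = L - k →
        IterPartialExists (List.replicate k i) Φ ∧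
        IterPartialExists (expWord cs m) (iterPartial (List.replicate k i) Φ) ∧
          ContinuousWithinAt (iterPartial (expWord cs m) (iterPartial (List.replicate k i) Φ))
            (Set.Icc 0 1) a := by
      intro k hk m hm hsum
      have h1 := hΦ (Function.update m i k) (fun j hj => by
        simp only [List.mem_append, List.mem_singleton, not_or] at hj
        rw [Function.update_of_ne hj.2, hm j hj.1])
        (by rw [sum_update_add _ _ _ (hm i hi)]; omega)
      rw [expWord_update hi, iterPartialExists_append, iterPartial_append] at h1
      exact ⟨h1.1.1, h1.1.2, h1.2⟩
    set Ψ : ℕ → (Fin N → ℝ) → ℝ := fun k => iterPartial (List.replicate k i) Φ with hΨ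
    set T : ℕ → (Fin N → ℝ) → ℝ := fun k z =>
      ∑ m ∈ expSet cs (L - k), iterPartial (expWord cs m) (Ψ k) a * mono m (z - a) with hT
    -- There are L + 1 errors to share: one from the expansion in `i`, and one from each of its L
    -- lower-order coefficients.
    have hε' : 0 < ε / (L + 2 : ℝ) := by positivity
    have hih : ∀ k, ∃ δ > 0, k < L → ∀ z ∈ Set.Icc (0 : Fin N → ℝ) 1, (∀ j, j ∉ cs → z j = a j) →
        ‖z - a‖ ≤ δ → |Ψ k z - T k z| ≤ ε / (L + 2 : ℝ) * ‖z - a‖ ^ (L - k) := by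
      intro k
      by_cases hk : k < L
      · obtain ⟨δ, hδ, hz⟩ := ih hcs (L - k) (Ψ k)
          (fun m hm hs => (hrep k hk.le m hm hs).2) _ hε'
        exact ⟨δ, hδ, fun _ => hz⟩
      · exact ⟨1, one_pos, fun h => absurd h hk⟩
    choose δ hδ hδz using hih
    obtain ⟨hexL, -, hcontL⟩ := hrep L le_rfl 0 (by simp) (by simp)
    have hw0 : expWord cs (0 : Fin N → ℕ) = [] := by simp [expWord]
    rw [hw0] at hcontL
    change ContinuousWithinAt (Ψ L) (Set.Icc 0 1) a at hcontL
    obtain ⟨η, hη, hηz⟩ := Metric.continuousWithinAt_iff.1 hcontL _ hε'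
    have hset : expSet cs 0 = {0} := by
      ext m
      simp only [mem_expSet, Finset.mem_singleton, Nat.le_zero, Finset.sum_eq_zero_iff,
        Finset.mem_univ, true_imp_iff]
      constructor
      · exact fun h => funext h.1
      · rintro rfl; simp
    -- The top coefficient is expanded to order 0 only, so continuity of the top derivative at `a`
    -- is enough.
    have hTL : ∀ z, T L z = Ψ L a := by
      intro z
      simp [hT, hset, hw0, iterPartial, mono]
    have hmin : ∃ δ₀ > 0, ∀ k < L, δ₀ ≤ δ k := by
      rcases Nat.eq_zero_or_pos L with h0 | h0
      · exact ⟨1, one_pos, fun k hk => by omega⟩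
      · obtain ⟨k₀, hk₀, hk₁⟩ := Finset.exists_min_image (Finset.range L) δ ⟨0, by simpa using h0⟩
        exact ⟨δ k₀, hδ k₀, fun k hk => hk₁ k (by simpa using hk)⟩
    obtain ⟨δ₀, hδ₀, hδ₀k⟩ := hmin
    -- Halving `η` turns the bound ≤ on the norm into the strict inequality of the continuity
    -- statement.
    refine ⟨min δ₀ (η / 2), by positivity, fun z hz hza hzn => ?_⟩
    set z' : Fin N → ℝ := Function.update z i (a i) with hz'
    have haI : ∀ j, a j ∈ Set.Icc (0 : ℝ) 1 := fun j => ⟨ha.1 j, ha.2 j⟩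
    have hzI : ∀ j, z j ∈ Set.Icc (0 : ℝ) 1 := fun j => ⟨hz.1 j, hz.2 j⟩
    have hz'c : z' ∈ Set.Icc (0 : Fin N → ℝ) 1 := update_mem_cube hz i (haI i)
    have hle : ∀ t ∈ Set.uIcc (a i) (z i), ‖Function.update z i t - a‖ ≤ ‖z - a‖ := by
      intro t ht
      refine (pi_norm_le_iff_of_nonneg (norm_nonneg _)).2 fun j => ?_
      by_cases hj : j = i
      · subst hj
        simp only [Pi.sub_apply, Function.update_self, Real.norm_eq_abs]
        exact (Set.abs_sub_left_of_mem_uIcc ht).trans (norm_le_pi_norm (z - a) j)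
      · simp only [Pi.sub_apply, Function.update_of_ne hj]
        exact norm_le_pi_norm (z - a) j
    have hz'n : ‖z' - a‖ ≤ ‖z - a‖ := hle _ Set.left_mem_uIcc
    have hz'a : ∀ j, j ∉ cs → z' j = a j := by
      intro j hj
      by_cases hji : j = i
      · subst hji; simp [hz']
      · rw [hz', Function.update_of_ne hji]
        exact hza j (by simp [hj, hji])
    -- expansion in the coordinate `i`
    have hone := taylor_chain_estimate (L := L) (φ := fun l t => Ψ l (Function.update z i t))
      (fun l hl t ht => hasDerivWithinAt_replicate hexL hz hl ht)
      (a := a i) (s := z i) (c := Ψ L a) (ε := ε / (L + 2 : ℝ)) (haI i) (hzI i) (by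
        intro t ht
        refine (hηz (update_mem_cube hz i ?_) ?_).le
        · exact (convex_Icc (0 : ℝ) 1).ordConnected.uIcc_subset (haI i) (hzI i) ht
        · rw [dist_eq_norm]
          have := (hle t ht).trans (hzn.trans (min_le_right _ _))
          linarith)
    simp only [Function.update_eq_self] at hone
    have hTz : ∀ k, T k z' = T k z := by
      intro k
      simp only [hT]
      refine Finset.sum_congr rfl fun m hm => ?_
      congr 1
      unfold mono
      refine Finset.prod_congr rfl fun j _ => ?_
      by_cases hj : j = i
      · subst hj
        rw [(mem_expSet.1 hm).2 j hi]; simp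
      · simp only [Pi.sub_apply, hz', Function.update_of_ne hj]
    have hsum : ∑ m ∈ expSet (cs ++ [i]) L, iterPartial (expWord (cs ++ [i]) m) Φ a * mono m (z - a) =
        ∑ k ∈ Finset.range L, T k z * ((z i - a i) ^ k / (k.factorial : ℝ)) +
          Ψ L a * ((z i - a i) ^ L / (L.factorial : ℝ)) := by
      rw [sum_expSet_append hi, ← hTL z, ← Finset.sum_range_succ
        (fun k => T k z * ((z i - a i) ^ k / (k.factorial : ℝ)))]
      refine Finset.sum_congr rfl fun k _ => ?_
      rw [hT, Finset.sum_mul]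
      refine Finset.sum_congr rfl fun m hm => ?_
      rw [expWord_update hi, iterPartial_append, mono_update ((mem_expSet.1 hm).2 i hi)]
      simp only [hΨ, Pi.sub_apply]
      ring
    have hzi : |z i - a i| ≤ ‖z - a‖ := norm_le_pi_norm (z - a) i
    have hterm : ∀ k ∈ Finset.range L,
        |(Ψ k z' - T k z) * ((z i - a i) ^ k / (k.factorial : ℝ))| ≤
          ε / (L + 2 : ℝ) * ‖z - a‖ ^ L := by
      intro k hk
      have hk' := Finset.mem_range.1 hk
      have h1 := hδz k hk' z' hz'c hz'a
        (hz'n.trans (hzn.trans ((min_le_left _ _).trans (hδ₀k k hk'))))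
      rw [hTz] at h1
      rw [abs_mul, abs_div, abs_pow, Nat.abs_cast]
      have h2 : |z i - a i| ^ k / (k.factorial : ℝ) ≤ ‖z - a‖ ^ k := by
        refine (div_le_self (by positivity) ?_).trans (pow_le_pow_left₀ (abs_nonneg _) hzi k)
        exact_mod_cast Nat.succ_le_of_lt k.factorial_pos
      have h3 : |Ψ k z' - T k z| ≤ ε / (L + 2 : ℝ) * ‖z - a‖ ^ (L - k) :=
        h1.trans (mul_le_mul_of_nonneg_left (pow_le_pow_left₀ (norm_nonneg _) hz'n _) hε'.le)
      calc _ ≤ ε / (L + 2 : ℝ) * ‖z - a‖ ^ (L - k) * ‖z - a‖ ^ k :=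
            mul_le_mul h3 h2 (by positivity) (by positivity)
        _ = _ := by rw [mul_assoc, ← pow_add, Nat.sub_add_cancel hk'.le]
    rw [hsum]
    -- The coefficients at `z'`, the projection of `z` onto the hyperplane through `a`, are
    -- exchanged for their own Taylor polynomials.
    have hdec : Φ z - (∑ k ∈ Finset.range L, T k z * ((z i - a i) ^ k / (k.factorial : ℝ)) +
          Ψ L a * ((z i - a i) ^ L / (L.factorial : ℝ))) =
        (Φ z - (∑ k ∈ Finset.range L, Ψ k z' * ((z i - a i) ^ k / (k.factorial : ℝ)) +
          Ψ L a * ((z i - a i) ^ L / (L.factorial : ℝ)))) +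
        ∑ k ∈ Finset.range L, (Ψ k z' - T k z) * ((z i - a i) ^ k / (k.factorial : ℝ)) := by
      simp only [sub_mul, Finset.sum_sub_distrib]
      ring
    rw [hdec]
    refine (abs_add_le _ _).trans ?_
    have h4 := (Finset.abs_sum_le_sum_abs _ _).trans (Finset.sum_le_sum hterm)
    rw [Finset.sum_const, Finset.card_range, nsmul_eq_mul] at h4
    have h5 : ε / (L + 2 : ℝ) * |z i - a i| ^ L ≤ ε / (L + 2 : ℝ) * ‖z - a‖ ^ L := by gcongr
    have h6 : ε / (L + 2 : ℝ) * ‖z - a‖ ^ L + L * (ε / (L + 2 : ℝ) * ‖z - a‖ ^ L) ≤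
        ε * ‖z - a‖ ^ L := by
      have : ε / (L + 2 : ℝ) * ‖z - a‖ ^ L + L * (ε / (L + 2 : ℝ) * ‖z - a‖ ^ L) =
        (L + 1) / (L + 2 : ℝ) * (ε * ‖z - a‖ ^ L) := by field_simp; ring
      rw [this]
      refine mul_le_of_le_one_left (by positivity) ?_
      rw [div_le_one (by positivity)]; linarith
    exact (add_le_add (hone.trans h5) h4).trans h6

/-- Taylor expansion on the closed cube, from the ordered partial derivatives of order `L`. -/
theorem taylor_cube {a : Fin N → ℝ} (ha : a ∈ Set.Icc (0 : Fin N → ℝ) 1) {L : ℕ}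
    {Φ : (Fin N → ℝ) → ℝ}
    (hΦ : ∀ m : Fin N → ℕ, ∑ j, m j = L → IterPartialExists (multiWord m) Φ ∧
      ContinuousWithinAt (iterPartial (multiWord m) Φ) (Set.Icc 0 1) a) {ε : ℝ} (hε : 0 < ε) :
    ∃ δ > 0, ∀ z ∈ Set.Icc (0 : Fin N → ℝ) 1, ‖z - a‖ ≤ δ →
      |Φ z - ∑ m ∈ multiIdx N L, iterPartial (multiWord m) Φ a * mono m (z - a)| ≤
        ε * ‖z - a‖ ^ L := by
  obtain ⟨δ, hδ, h⟩ := taylor_expSet ha (List.finRange N) (List.nodup_finRange N) L Φ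
    (fun m _ hm => hΦ m hm) ε hε
  refine ⟨δ, hδ, fun z hz hzn => ?_⟩
  have hset : expSet (List.finRange N) L = multiIdx N L := by
    ext m; simp [mem_expSet, mem_multiIdx]
  have := h z hz (fun j hj => absurd (List.mem_finRange j) hj) hzn
  rwa [hset] at this

/-! ### Convergence in probability of kernel averages and its transfer. -/

/-- Weak law of large numbers for kernel-weighted averages of a random sample. -/
theorem tendstoInMeasure_kernel_average {Ω S : Type*} [MeasurableSpace Ω] [MeasurableSpace S]
    {P : Measure Ω} [IsProbabilityMeasure P] {Z : ℕ → Ω → S} (hZ : ∀ i, Measurable (Z i))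
    (hind : iIndepFun Z P) {ρ : Measure S} (hlaw : ∀ i, P.map (Z i) = ρ) {ψ : ℕ → S → ℝ}
    (hψ : ∀ n, Measurable (ψ n)) {C : ℝ} (hC : ∀ n z, |ψ n z| ≤ C) {b : ℕ → ℝ}
    (hb : ∀ n, 0 < b n) (hnb : Tendsto (fun n : ℕ => (n : ℝ) * b n) atTop atTop) {t t' : ℝ}
    (hmean : Tendsto (fun n => (∫ z, ψ n z ∂ρ) / b n) atTop (𝓝 t))
    (habs : Tendsto (fun n => (∫ z, |ψ n z| ∂ρ) / b n) atTop (𝓝 t')) :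
    TendstoInMeasure P
      (fun (n : ℕ) ω => 1 / ((n : ℝ) * b n) * ∑ i ∈ Finset.range n, ψ n (Z i ω)) atTop
      (fun _ => t) := by
  have hρ : IsProbabilityMeasure ρ := by
    rw [← hlaw 0]; exact Measure.isProbabilityMeasure_map (hZ 0).aemeasurable
  have hmem : ∀ n i, MemLp (fun ω => ψ n (Z i ω)) 2 P := fun n i =>
    MemLp.of_bound ((hψ n).comp (hZ i)).aestronglyMeasurable C
      (Eventually.of_forall fun ω => hC n _)
  have hint : ∀ n i, ∫ ω, ψ n (Z i ω) ∂P = ∫ z, ψ n z ∂ρ := fun n i => by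
    rw [← hlaw i, integral_map (hZ i).aemeasurable (hψ n).aestronglyMeasurable]
  have hC0 : 0 ≤ C := by
    obtain ⟨z⟩ : Nonempty S := nonempty_of_isProbabilityMeasure ρ
    exact (abs_nonneg _).trans (hC 0 z)
  have hintρ : ∀ n, Integrable (ψ n) ρ := fun n =>
    Integrable.of_bound (hψ n).aestronglyMeasurable C (Eventually.of_forall (hC n))
  -- From ψ² ≤ C |ψ| the second moment is of order `b n`, not merely bounded, so the variance of the
  -- average is of order 1/(n b).
  have hvar1 : ∀ n i, variance (fun ω => ψ n (Z i ω)) P ≤ C * ∫ z, |ψ n z| ∂ρ := by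
    intro n i
    refine (variance_le_expectation_sq (hmem n i).aestronglyMeasurable).trans ?_
    have h1 : P[(fun ω => ψ n (Z i ω)) ^ 2] = ∫ z, ψ n z ^ 2 ∂ρ := by
      rw [← hlaw i, integral_map (hZ i).aemeasurable ((hψ n).pow_const 2).aestronglyMeasurable]
      rfl
    rw [h1, ← integral_const_mul]
    refine integral_mono_of_nonneg (Eventually.of_forall fun z => sq_nonneg _)
      ((hintρ n).abs.const_mul C) (Eventually.of_forall fun z => ?_)
    change ψ n z ^ 2 ≤ C * |ψ n z|
    rw [← sq_abs, sq]
    exact mul_le_mul_of_nonneg_right (hC n z) (abs_nonneg _)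
  set W : ℕ → Ω → ℝ := fun n ω => 1 / ((n : ℝ) * b n) * ∑ i ∈ Finset.range n, ψ n (Z i ω) with hW
  have hWmem : ∀ n, MemLp (W n) 2 P := fun n =>
    (memLp_finsetSum _ fun i _ => hmem n i).const_mul _
  have hWmean : ∀ n, 0 < n → P[W n] = (∫ z, ψ n z ∂ρ) / b n := by
    intro n hn
    simp only [hW]
    rw [integral_const_mul, integral_finsetSum _ fun i _ => (hmem n i).integrable one_le_two]
    simp only [hint, Finset.sum_const, Finset.card_range, nsmul_eq_mul]
    have : (n : ℝ) ≠ 0 := by positivity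
    have := (hb n).ne'
    field_simp
  have hWvar : ∀ n, 0 < n → variance (W n) P ≤
      C * ((∫ z, |ψ n z| ∂ρ) / b n) * ((n : ℝ) * b n)⁻¹ := by
    intro n hn
    have h1 : variance (W n) P = (1 / ((n : ℝ) * b n)) ^ 2 *
        ∑ i ∈ Finset.range n, variance (fun ω => ψ n (Z i ω)) P := by
      rw [← IndepFun.variance_sum (fun i _ => hmem n i)
        (fun i _ j _ hij => (hind.indepFun hij).comp (hψ n) (hψ n)), ← variance_const_mul]
      congr 1
      ext ω; simp [hW]
    rw [h1]
    have h2 := Finset.sum_le_sum fun i (_ : i ∈ Finset.range n) => hvar1 n i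
    rw [Finset.sum_const, Finset.card_range, nsmul_eq_mul] at h2
    refine (mul_le_mul_of_nonneg_left h2 (sq_nonneg _)).trans_eq ?_
    have : (n : ℝ) ≠ 0 := by positivity
    have := (hb n).ne'
    field_simp
  rw [tendstoInMeasure_iff_dist]
  intro ε hε
  have hlim : Tendsto (fun n : ℕ => ENNReal.ofReal
      (C * ((∫ z, |ψ n z| ∂ρ) / b n) * ((n : ℝ) * b n)⁻¹ / (ε / 2) ^ 2)) atTop (𝓝 0) := by
    rw [← ENNReal.ofReal_zero]
    refine ENNReal.tendsto_ofReal ?_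
    have := ((habs.const_mul C).mul hnb.inv_tendsto_atTop).div_const ((ε / 2) ^ 2)
    simpa using this
  refine tendsto_of_tendsto_of_tendsto_of_le_of_le' tendsto_const_nhds hlim
    (Eventually.of_forall fun _ => zero_le) ?_
  -- Half of `ε` is spent on the bias of the mean, the other half on Chebyshev's inequality.
  filter_upwards [Metric.tendsto_nhds.1 hmean (ε / 2) (by positivity), eventually_gt_atTop 0]
    with n hn hn0
  refine (measure_mono ?_).trans ((meas_ge_le_variance_div_sq (hWmem n) (half_pos hε)).trans ?_)
  · intro ω hω
    change ε ≤ dist (W n ω) t at hω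
    change ε / 2 ≤ |W n ω - P[W n]|
    rw [hWmean n hn0, ← Real.dist_eq]
    have := dist_triangle (W n ω) ((∫ z, ψ n z ∂ρ) / b n) t
    linarith
  · exact ENNReal.ofReal_le_ofReal (by gcongr; exact hWvar n hn0)

/-- Transfer of a deterministic limit along a filter to convergence in probability. -/
theorem tendstoInMeasure_of_statistics {Ω κ : Type*} [MeasurableSpace Ω] [Fintype κ]
    {P : Measure Ω} {D : ℕ → Ω → ℝ} {T : κ → ℕ → Ω → ℝ} {t : κ → ℝ}
    (hT : ∀ k, TendstoInMeasure P (T k) atTop fun _ => t k) {good : Set Ω}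
    (hgood : P goodᶜ = 0)
    (hD : ∀ l : Filter (ℕ × Ω), Tendsto Prod.fst l atTop → (∀ᶠ i in l, i.2 ∈ good) →
      (∀ k, Tendsto (fun i : ℕ × Ω => T k i.1 i.2) l (𝓝 (t k))) →
      Tendsto (fun i : ℕ × Ω => D i.1 i.2) l (𝓝 0)) :
    TendstoInMeasure P D atTop fun _ => 0 := by
  set s : Finset κ := Finset.univ
  -- The largest filter satisfying the three premises of `hD`. Convergence along it unwinds to one δ
  -- and one n₀ valid for all good outcomes, and the bad event is then covered by a finite union.
  set l : Filter (ℕ × Ω) := comap Prod.fst atTop ⊓ 𝓟 {i | i.2 ∈ good} ⊓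
    ⨅ k ∈ s, comap (fun i : ℕ × Ω => T k i.1 i.2) (𝓝 (t k)) with hl
  have hlim := hD l (tendsto_comap.mono_left (inf_le_left.trans inf_le_left))
    (mem_of_superset (mem_inf_of_left (mem_inf_of_right (mem_principal_self _))) fun _ h => h)
    (fun k => tendsto_comap.mono_left (inf_le_right.trans (iInf₂_le k (Finset.mem_univ k))))
  rw [tendstoInMeasure_iff_dist]
  intro ε hε
  have hmem : {i : ℕ × Ω | dist (D i.1 i.2) 0 < ε} ∈ l := Metric.tendsto_nhds.1 hlim ε hε
  have hex : ∃ δ > 0, ∃ n₀ : ℕ, ∀ n ≥ n₀, ∀ ω ∈ good,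
      (∀ k ∈ s, dist (T k n ω) (t k) < δ) → dist (D n ω) 0 < ε := by
    rw [hl, mem_inf_iff_superset] at hmem
    obtain ⟨A, hA, B, hB, hAB⟩ := hmem
    obtain ⟨A', hA', B', hB', hAB'⟩ := mem_inf_iff_superset.1 hA
    obtain ⟨A'', hA'', hAA⟩ := mem_comap.1 hA'
    obtain ⟨n₀, hn₀⟩ := mem_atTop_sets.1 hA''
    have hBδ : ∃ δ > 0, ∀ i : ℕ × Ω, (∀ k ∈ s, dist (T k i.1 i.2) (t k) < δ) → i ∈ B := by
      obtain ⟨p, hp, rfl⟩ := mem_iInf_finset.1 hB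
      have hex : ∀ k, ∃ δ > 0, k ∈ s → ∀ i : ℕ × Ω, dist (T k i.1 i.2) (t k) < δ → i ∈ p k := by
        intro k
        by_cases hk : k ∈ s
        · obtain ⟨V, hV, hVp⟩ := mem_comap.1 (hp k hk)
          obtain ⟨δ, hδ, hδV⟩ := Metric.mem_nhds_iff.1 hV
          exact ⟨δ, hδ, fun _ i hi => hVp (hδV hi)⟩
        · exact ⟨1, one_pos, fun h => absurd h hk⟩
      choose δ hδ hδp using hex
      rcases s.eq_empty_or_nonempty with hs | hs
      · exact ⟨1, one_pos, fun i _ => by simp [hs]⟩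
      · obtain ⟨k₀, _, hk₁⟩ := Finset.exists_min_image s δ hs
        exact ⟨δ k₀, hδ k₀, fun i hi => Set.mem_iInter₂.2 fun k hk =>
          hδp k hk i ((hi k hk).trans_le (hk₁ k hk))⟩
    obtain ⟨δ, hδ, hδB⟩ := hBδ
    refine ⟨δ, hδ, n₀, fun n hn ω hω hk => ?_⟩
    exact hAB (show (n, ω) ∈ A ∩ B from
      ⟨hAB' ⟨hAA (hn₀ n hn), mem_principal.1 hB' hω⟩, hδB _ hk⟩)
  obtain ⟨δ, hδ, n₀, hmain⟩ := hex
  have hsum : Tendsto (fun n => ∑ k ∈ s, P {ω | δ ≤ dist (T k n ω) (t k)}) atTop (𝓝 0) := by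
    rw [← Finset.sum_const_zero (s := s)]
    exact tendsto_finsetSum _ fun k _ => (tendstoInMeasure_iff_dist.1 (hT k)) δ hδ
  refine tendsto_of_tendsto_of_tendsto_of_le_of_le' tendsto_const_nhds hsum
    (Eventually.of_forall fun _ => zero_le) ?_
  filter_upwards [eventually_ge_atTop n₀] with n hn
  calc P {ω | ε ≤ dist (D n ω) 0} ≤ P (goodᶜ ∪ ⋃ k ∈ s, {ω | δ ≤ dist (T k n ω) (t k)}) := by
        refine measure_mono fun ω hω => ?_
        by_contra hcon
        simp only [Set.mem_union, Set.mem_compl_iff, Set.mem_iUnion, not_or, not_not, not_exists]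
          at hcon
        have := hmain n hn ω hcon.1 fun k hk => not_le.1 (hcon.2 k hk)
        exact absurd hω (not_le.2 this)
    _ ≤ P goodᶜ + ∑ k ∈ s, P {ω | δ ≤ dist (T k n ω) (t k)} :=
        (measure_union_le _ _).trans (add_le_add le_rfl (measure_biUnion_finset_le _ _))
    _ = _ := by rw [hgood, zero_add]

/-! ### Orders of magnitude in the bias expansion. -/

variable {ι : Type*} {l : Filter ι}

/-- Pairs `(k, m)` of exponents of total degree at most `M`. -/
def degPairs (d M : ℕ) : Finset (ℕ × (Fin d → ℕ)) :=
  (Finset.range (M + 1) ×ˢ multiIdx d M).filter fun s => s.1 + ∑ j, s.2 j ≤ M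

theorem mem_degPairs {d M : ℕ} {s : ℕ × (Fin d → ℕ)} :
    s ∈ degPairs d M ↔ s.1 + ∑ j, s.2 j ≤ M := by
  simp only [degPairs, Finset.mem_filter, Finset.mem_product, Finset.mem_range, mem_multiIdx]
  omega

/-- As x ≤ 1, it suffices to exceed either exponent of the rate by `r`: dropping the other summand
of the denominator only enlarges the quotient. -/
theorem pow_div_rate_le {x : ℝ} (hx : 0 < x) (hx1 : x ≤ 1) {A B e r : ℕ}
    (h : A + r ≤ e ∨ B + r ≤ e) : x ^ e / (x ^ A + x ^ B) ≤ x ^ r := by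
  rw [div_le_iff₀ (by positivity), mul_add, ← pow_add, ← pow_add]
  rcases h with h | h
  · have := pow_le_pow_of_le_one hx.le hx1 (show r + A ≤ e by omega)
    have : 0 ≤ x ^ (r + B) := by positivity
    linarith
  · have := pow_le_pow_of_le_one hx.le hx1 (show r + B ≤ e by omega)
    have : 0 ≤ x ^ (r + A) := by positivity
    linarith

theorem tendsto_pow_div_rate {h : ι → ℝ} (hpos : ∀ᶠ i in l, 0 < h i) (hzero : Tendsto h l (𝓝 0))
    {A B e : ℕ} (he : A + 1 ≤ e ∨ B + 1 ≤ e) :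
    Tendsto (fun i => h i ^ e / (h i ^ A + h i ^ B)) l (𝓝 0) := by
  refine squeeze_zero' ?_ ?_ hzero
  · filter_upwards [hpos] with i hi
    positivity
  · filter_upwards [hpos, hzero.eventually_le_const one_pos] with i hi hi1
    simpa using pow_div_rate_le hi hi1 he

theorem tendsto_pow_div_rate_mul {h : ι → ℝ} (hpos : ∀ᶠ i in l, 0 < h i)
    (hzero : Tendsto h l (𝓝 0)) {A B e : ℕ} (he : A ≤ e ∨ B ≤ e) {φ : ι → ℝ}
    (hφ : Tendsto φ l (𝓝 0)) :
    Tendsto (fun i => h i ^ e / (h i ^ A + h i ^ B) * φ i) l (𝓝 0) := by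
  refine squeeze_zero_norm' ?_ (by simpa using hφ.norm)
  filter_upwards [hpos, hzero.eventually_le_const one_pos] with i hi hi1
  rw [norm_mul]
  refine mul_le_of_le_one_left (norm_nonneg _) ?_
  rw [Real.norm_of_nonneg (by positivity)]
  simpa using pow_div_rate_le (r := 0) hi hi1 he

/-- Bias expansion in terms of the extracted coefficients `α`, `β`. -/
theorem tendsto_bias_expansion {d p q μ M : ℕ} {ν : Fin d → ℕ} (hμ : μ ≤ p) (hν : ∑ j, ν j ≤ q)
    (hM₁ : q + 1 + μ ≤ M) (hM₂ : p + 1 + ∑ j, ν j ≤ M) {h : ι → ℝ}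
    (hpos : ∀ᶠ i in l, 0 < h i) (hzero : Tendsto h l (𝓝 0)) (θ : ℕ → (Fin d → ℕ) → ℝ)
    {α : ℕ → ι → ℝ} {β : (Fin d → ℕ) → ι → ℝ} {α₀ : ℕ → ℝ} {β₀ : (Fin d → ℕ) → ℝ}
    (hα : ∀ k ≤ M, Tendsto (α k) l (𝓝 (α₀ k)))
    (hβ : ∀ m : Fin d → ℕ, ∑ j, m j ≤ M → Tendsto (β m) l (𝓝 (β₀ m)))
    (hα1 : ∀ᶠ i in l, ∀ k ≤ p, α k i = if k = μ then 1 else 0)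
    (hβ1 : ∀ᶠ i in l, ∀ m : Fin d → ℕ, ∑ j, m j ≤ q → β m i = if m = ν then 1 else 0)
    {α' : ι → ℝ} {β' : (Fin d → ℕ) → ι → ℝ} (hα' : Tendsto α' l (𝓝 (α₀ (p + 1))))
    (hβ' : ∀ m, Tendsto (β' m) l (𝓝 (β₀ m))) :
    Tendsto (fun i => (∑ s ∈ degPairs d M, h i ^ (s.1 + ∑ j, s.2 j) / h i ^ (μ + ∑ j, ν j) *
        (θ s.1 s.2 * (α s.1 i * β s.2 i)) -
      (θ μ ν + (h i ^ (q + 1 - ∑ j, ν j) *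
          (∑ m ∈ multiIdx d (q + 1) with ∑ j, m j = q + 1, θ μ m * β' m i) +
        h i ^ (p + 1 - μ) * (θ (p + 1) ν * α' i)))) /
      (h i ^ (q + 1 - ∑ j, ν j) + h i ^ (p + 1 - μ))) l (𝓝 0) := by
  set A := q + 1 - ∑ j, ν j with hA
  set B := p + 1 - μ with hB
  -- The target is distributed over the exponent pairs, so that the comparison can be made one pair
  -- at a time.
  set τ : ℕ × (Fin d → ℕ) → ι → ℝ := fun s i =>
    (if s = (μ, ν) then θ μ ν else 0) +
    (if s.1 = μ ∧ ∑ j, s.2 j = q + 1 then h i ^ A * (θ μ s.2 * β' s.2 i) else 0) +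
    (if s = (p + 1, ν) then h i ^ B * (θ (p + 1) ν * α' i) else 0) with hτ
  have hsum : ∀ i, θ μ ν + (h i ^ A *
          (∑ m ∈ multiIdx d (q + 1) with ∑ j, m j = q + 1, θ μ m * β' m i) +
        h i ^ B * (θ (p + 1) ν * α' i)) = ∑ s ∈ degPairs d M, τ s i := by
    intro i
    simp only [hτ, Finset.sum_add_distrib]
    rw [Finset.sum_ite_eq', Finset.sum_ite_eq', if_pos (mem_degPairs.2 (by simp only; omega)),
      if_pos (mem_degPairs.2 (by simpa using hM₂)), ← Finset.sum_filter, Finset.mul_sum, add_assoc]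
    congr 2
    refine Finset.sum_nbij' (fun m => (μ, m)) Prod.snd ?_ ?_ ?_ ?_ ?_
    · intro m hm
      simp only [Finset.mem_filter, mem_degPairs, mem_multiIdx] at hm ⊢
      exact ⟨by omega, trivial, hm.2⟩
    · intro s hs
      simp only [Finset.mem_filter, mem_degPairs, mem_multiIdx] at hs ⊢
      exact ⟨hs.2.2.le, hs.2.2⟩
    · intros; rfl
    · rintro ⟨k, m⟩ hs
      simp only [Finset.mem_filter] at hs
      simp [hs.2.1]
    · intros; rfl
  simp_rw [hsum, ← Finset.sum_sub_distrib, Finset.sum_div]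
  rw [← Finset.sum_const_zero (s := degPairs d M)]
  refine tendsto_finsetSum _ fun s hs => ?_
  obtain ⟨k, m⟩ := s
  rw [mem_degPairs] at hs
  simp only at hs
  have hpw : ∀ {x : ℝ}, 0 < x → ∀ {e : ℕ}, μ + ∑ j, ν j ≤ e →
      x ^ e / x ^ (μ + ∑ j, ν j) = x ^ (e - (μ + ∑ j, ν j)) := fun hx e he =>
    (pow_sub₀ _ hx.ne' he).symm
  simp only [hτ, Prod.mk.injEq]
  -- If both indices are low the terms agree exactly. If one is low, its Kronecker delta removes all
  -- but one value of it, and the other index either gives a leading bias term or a higher power of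
  -- h. If both are high, the term is negligible.
  rcases le_or_gt k p with hk | hk <;> rcases le_or_gt (∑ j, m j) q with hm | hm
  · refine tendsto_const_nhds.congr' ?_
    filter_upwards [hα1, hβ1, hpos] with i h1 h2 hi
    rw [h1 k hk, h2 m hm, if_neg (show ¬ (k = μ ∧ ∑ j, m j = q + 1) by omega),
      if_neg (show ¬ (k = p + 1 ∧ m = ν) by omega)]
    by_cases hkμ : k = μ
    · by_cases hmν : m = ν
      · subst hkμ hmν
        simp [div_self (pow_pos hi _).ne']
      · simp [hmν]
    · simp [hkμ]
  · have hmν : m ≠ ν := by rintro rfl; omega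
    by_cases hkμ : k = μ
    · subst hkμ
      by_cases hmq : ∑ j, m j = q + 1
      · have h0 : Tendsto (fun i => θ k m * (β m i - β' m i)) l (𝓝 0) := by
          simpa using ((hβ m (by omega)).sub (hβ' m)).const_mul (θ k m)
        refine (tendsto_pow_div_rate_mul (A := A) (B := B) hpos hzero (Or.inl le_rfl) h0).congr' ?_
        filter_upwards [hα1, hpos] with i h1 hi
        rw [h1 k hk, hpw hi (by omega), if_pos rfl, hmq,
          show k + (q + 1) - (k + ∑ j, ν j) = A by omega]
        simp only [hmν, and_false, and_self, if_false, if_true]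
        ring
      · have h0 : Tendsto (fun i => h i ^ (∑ j, m j - ∑ j, ν j) / (h i ^ A + h i ^ B) *
            (θ k m * β m i)) l (𝓝 0) := by
          simpa using (tendsto_pow_div_rate (A := A) (B := B) hpos hzero
            (Or.inl (by omega))).mul ((hβ m (by omega)).const_mul (θ k m))
        refine h0.congr' ?_
        filter_upwards [hα1, hpos] with i h1 hi
        rw [h1 k hk, hpw hi (by omega), if_pos rfl,
          show k + ∑ j, m j - (k + ∑ j, ν j) = ∑ j, m j - ∑ j, ν j by omega]
        simp only [hmν, hmq, and_false, if_false]
        ring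
    · refine tendsto_const_nhds.congr' ?_
      filter_upwards [hα1] with i h1
      rw [h1 k hk]
      simp [hkμ, hmν]
  · have hkμ : k ≠ μ := by omega
    by_cases hmν : m = ν
    · subst hmν
      by_cases hkp : k = p + 1
      · subst hkp
        have h0 : Tendsto (fun i => θ (p + 1) m * (α (p + 1) i - α' i)) l (𝓝 0) := by
          simpa using ((hα (p + 1) (by omega)).sub hα').const_mul (θ (p + 1) m)
        refine (tendsto_pow_div_rate_mul (A := A) (B := B) hpos hzero (Or.inr le_rfl) h0).congr' ?_
        filter_upwards [hβ1, hpos] with i h1 hi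
        rw [h1 m hm, hpw hi (by omega), if_pos rfl,
          show p + 1 + ∑ j, m j - (μ + ∑ j, m j) = B by omega]
        simp only [hkμ, false_and, if_false, and_self, if_true]
        ring
      · have h0 : Tendsto (fun i => h i ^ (k - μ) / (h i ^ A + h i ^ B) *
            (θ k m * α k i)) l (𝓝 0) := by
          simpa using (tendsto_pow_div_rate (A := A) (B := B) hpos hzero
            (Or.inr (by omega))).mul ((hα k (by omega)).const_mul (θ k m))
        refine h0.congr' ?_
        filter_upwards [hβ1, hpos] with i h1 hi
        rw [h1 m hm, hpw hi (by omega), if_pos rfl,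
          show k + ∑ j, m j - (μ + ∑ j, m j) = k - μ by omega]
        simp only [hkμ, hkp, false_and, if_false]
        ring
    · refine tendsto_const_nhds.congr' ?_
      filter_upwards [hβ1] with i h1
      rw [h1 m hm]
      simp [hkμ, hmν]
  · have hkμ : k ≠ μ := by omega
    have hmν : m ≠ ν := by rintro rfl; omega
    -- Here |m| - |ν| ≥ A and k - μ ≥ 1, so the exponent exceeds `A` by at least one.
    have h0 : Tendsto (fun i => h i ^ (k + ∑ j, m j - (μ + ∑ j, ν j)) / (h i ^ A + h i ^ B) *
        (θ k m * (α k i * β m i))) l (𝓝 0) := by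
      simpa using (tendsto_pow_div_rate (A := A) (B := B) hpos hzero
        (Or.inl (by omega))).mul (((hα k (by omega)).mul (hβ m (by omega))).const_mul (θ k m))
    refine h0.congr' ?_
    filter_upwards [hpos] with i hi
    rw [hpw hi (by omega)]
    simp only [hkμ, hmν, false_and, and_false, if_false]
    ring

/-! ### Matrix algebra of the sandwich. -/

section Matrices

variable {κ κ' : Type*} [Fintype κ] [DecidableEq κ] [Fintype κ'] [DecidableEq κ']

theorem tendsto_matrix_inv {S : ι → Matrix κ κ ℝ} {S₀ : Matrix κ κ ℝ} (hS : Tendsto S l (𝓝 S₀))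
    (hdet : S₀.det ≠ 0) : Tendsto (fun i => (S i)⁻¹) l (𝓝 S₀⁻¹) := by
  simp_rw [Matrix.inv_def, Ring.inverse_eq_inv']
  have h1 : Tendsto (fun i => (S i).det) l (𝓝 S₀.det) :=
    ((continuous_id.matrix_det).tendsto S₀).comp hS
  have h2 : Tendsto (fun i => (S i).adjugate) l (𝓝 S₀.adjugate) :=
    ((continuous_id.matrix_adjugate).tendsto S₀).comp hS
  exact (h1.inv₀ hdet).smul h2

omit [DecidableEq κ] [DecidableEq κ'] in
theorem dotProduct_vecMulVec_sandwich (A : Matrix κ κ ℝ) (B : Matrix κ' κ' ℝ) (u a : κ → ℝ)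
    (v b : κ' → ℝ) :
    u ⬝ᵥ (A * Matrix.vecMulVec a b * B).mulVec v = (u ⬝ᵥ A.mulVec a) * (b ⬝ᵥ B.mulVec v) := by
  rw [Matrix.mul_vecMulVec, Matrix.vecMulVec_mul, Matrix.vecMulVec_mulVec, ← Matrix.dotProduct_mulVec]
  simp [dotProduct_smul, mul_comm]

/-- Polynomial reproduction in the response: it yields α_k = 1{k = μ} for k ≤ p without error, even
when S is random. -/
theorem inv_mulVec_col {S : Matrix κ κ ℝ} (hS : S.det ≠ 0) (k : κ) :
    S⁻¹.mulVec (fun a => S a k) = Pi.single k 1 := by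
  have : (fun a => S a k) = S.mulVec (Pi.single k 1) := by
    ext a; simp
  rw [this, Matrix.mulVec_mulVec, Matrix.nonsing_inv_mul _ (isUnit_iff_ne_zero.2 hS),
    Matrix.one_mulVec]

/-- Polynomial reproduction in the covariates, the counterpart of `inv_mulVec_col` on the right of
the sandwich. -/
theorem row_dotProduct_inv_mulVec {S : Matrix κ κ ℝ} (hS : S.det ≠ 0) (k : κ) (v : κ → ℝ) :
    (fun b => S k b) ⬝ᵥ S⁻¹.mulVec v = v k := by
  change S.mulVec (S⁻¹.mulVec v) k = v k
  rw [Matrix.mulVec_mulVec, Matrix.mul_nonsing_inv _ (isUnit_iff_ne_zero.2 hS), Matrix.one_mulVec]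

omit [DecidableEq κ] [DecidableEq κ'] in
theorem tendsto_dotProduct_mulVec {A : ι → Matrix κ κ' ℝ} {A₀ : Matrix κ κ' ℝ} {u : ι → κ → ℝ}
    {u₀ : κ → ℝ} {v : ι → κ' → ℝ} {v₀ : κ' → ℝ} (hu : Tendsto u l (𝓝 u₀))
    (hA : Tendsto A l (𝓝 A₀)) (hv : Tendsto v l (𝓝 v₀)) :
    Tendsto (fun i => u i ⬝ᵥ (A i).mulVec (v i)) l (𝓝 (u₀ ⬝ᵥ A₀.mulVec v₀)) := by
  simp only [dotProduct, Matrix.mulVec]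
  exact tendsto_finsetSum _ fun a _ => (tendsto_pi_nhds.1 hu a).mul
    (tendsto_finsetSum _ fun b _ =>
      (tendsto_pi_nhds.1 (tendsto_pi_nhds.1 hA a) b).mul (tendsto_pi_nhds.1 hv b))

omit [DecidableEq κ] [DecidableEq κ'] in
theorem tendsto_dotProduct_sandwich {A : ι → Matrix κ κ ℝ} {A₀ : Matrix κ κ ℝ}
    {B : ι → Matrix κ' κ' ℝ} {B₀ : Matrix κ' κ' ℝ} {E : ι → Matrix κ κ' ℝ}
    (hA : Tendsto A l (𝓝 A₀)) (hB : Tendsto B l (𝓝 B₀))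
    (hE : ∀ a b, Tendsto (fun i => E i a b) l (𝓝 0)) (u : κ → ℝ) (v : κ' → ℝ) :
    Tendsto (fun i => u ⬝ᵥ (A i * E i * B i).mulVec v) l (𝓝 0) := by
  have h0 : Tendsto E l (𝓝 0) := tendsto_pi_nhds.2 fun a => tendsto_pi_nhds.2 fun b => hE a b
  have hc : Continuous fun z : Matrix κ κ ℝ × Matrix κ κ' ℝ × Matrix κ' κ' ℝ =>
      z.1 * z.2.1 * z.2.2 :=
    (continuous_fst.matrix_mul continuous_snd.fst).matrix_mul continuous_snd.snd
  have h1 := (hc.tendsto (A₀, 0, B₀)).comp (hA.prodMk_nhds (h0.prodMk_nhds hB))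
  have h2 := tendsto_dotProduct_mulVec (tendsto_const_nhds (x := u)) h1
    (tendsto_const_nhds (x := v))
  simpa using h2

omit [DecidableEq κ] [DecidableEq κ'] in
theorem dotProduct_sandwich_sum {σ : Type*} (s : Finset σ) (A : Matrix κ κ ℝ) (B : Matrix κ' κ' ℝ)
    (u : κ → ℝ) (v : κ' → ℝ) (t : σ → ℝ) (a : σ → κ → ℝ) (b : σ → κ' → ℝ) (r : ℝ)
    (E : Matrix κ κ' ℝ) :
    u ⬝ᵥ (A * (∑ x ∈ s, t x • Matrix.vecMulVec (a x) (b x) + r • E) * B).mulVec v =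
      ∑ x ∈ s, t x * ((u ⬝ᵥ A.mulVec (a x)) * (b x ⬝ᵥ B.mulVec v)) +
        r * (u ⬝ᵥ (A * E * B).mulVec v) := by
  rw [Matrix.mul_add, Matrix.add_mul, Matrix.add_mulVec, dotProduct_add, Matrix.mul_sum,
    Matrix.sum_mul, Matrix.sum_mulVec, dotProduct_sum]
  congr 1
  · refine Finset.sum_congr rfl fun x _ => ?_
    rw [Matrix.mul_smul, Matrix.smul_mul, Matrix.smul_mulVec, dotProduct_smul,
      dotProduct_vecMulVec_sandwich, smul_eq_mul]
  · rw [Matrix.mul_smul, Matrix.smul_mul, Matrix.smul_mulVec, dotProduct_smul, smul_eq_mul]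

end Matrices

/-- Expansion of `e_μᵀ S_y⁻¹ R S_x⁻¹ e_ν` for a bracket `R` with a Taylor expansion. -/
theorem tendsto_sandwich_bias {d p q μ M : ℕ} {ν : Fin d → ℕ} (hμ : μ ≤ p) (hν : ∑ j, ν j ≤ q)
    (hM₁ : q + 1 + μ ≤ M) (hM₂ : p + 1 + ∑ j, ν j ≤ M) {h : ι → ℝ}
    (hpos : ∀ᶠ i in l, 0 < h i) (hzero : Tendsto h l (𝓝 0)) (θ : ℕ → (Fin d → ℕ) → ℝ)
    {Sy : ι → Matrix (Fin (p + 1)) (Fin (p + 1)) ℝ} {Sy₀ : Matrix (Fin (p + 1)) (Fin (p + 1)) ℝ}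
    (hSy : Tendsto Sy l (𝓝 Sy₀)) (hSy₀ : Sy₀.det ≠ 0)
    {Sx : ι → Matrix (multiIdx d q) (multiIdx d q) ℝ}
    {Sx₀ : Matrix (multiIdx d q) (multiIdx d q) ℝ}
    (hSx : Tendsto Sx l (𝓝 Sx₀)) (hSx₀ : Sx₀.det ≠ 0)
    {cy : ℕ → ι → Fin (p + 1) → ℝ} {cy₀ : ℕ → Fin (p + 1) → ℝ}
    (hcy : ∀ k ≤ M, Tendsto (cy k) l (𝓝 (cy₀ k)))
    {cx : (Fin d → ℕ) → ι → multiIdx d q → ℝ} {cx₀ : (Fin d → ℕ) → multiIdx d q → ℝ}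
    (hcx : ∀ m : Fin d → ℕ, ∑ j, m j ≤ M → Tendsto (cx m) l (𝓝 (cx₀ m)))
    (hcyS : ∀ i (k : Fin (p + 1)) a, cy k i a = Sy i a k)
    (hcxS : ∀ i (m : multiIdx d q) b, cx m i b = Sx i m b)
    {R E : ι → Matrix (Fin (p + 1)) (multiIdx d q) ℝ}
    (hR : ∀ᶠ i in l, ∀ a b, h i ^ (μ + ∑ j, ν j) * R i a b =
      (∑ s ∈ degPairs d M, h i ^ (s.1 + ∑ j, s.2 j) * θ s.1 s.2 * (cy s.1 i a * cx s.2 i b)) +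
        E i a b)
    (hE : ∀ a b, Tendsto (fun i => E i a b / h i ^ M) l (𝓝 0))
    {α' : ι → ℝ} {β' : (Fin d → ℕ) → ι → ℝ}
    (hα' : Tendsto α' l (𝓝 (eY p μ ⬝ᵥ Sy₀⁻¹.mulVec (cy₀ (p + 1)))))
    (hβ' : ∀ m, Tendsto (β' m) l (𝓝 (cx₀ m ⬝ᵥ Sx₀⁻¹.mulVec (eX q ν)))) :
    Tendsto (fun i => (eY p μ ⬝ᵥ ((Sy i)⁻¹ * R i * (Sx i)⁻¹).mulVec (eX q ν) -
      (θ μ ν + (h i ^ (q + 1 - ∑ j, ν j) *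
          (∑ m ∈ multiIdx d (q + 1) with ∑ j, m j = q + 1, θ μ m * β' m i) +
        h i ^ (p + 1 - μ) * (θ (p + 1) ν * α' i)))) /
      (h i ^ (q + 1 - ∑ j, ν j) + h i ^ (p + 1 - μ))) l (𝓝 0) := by
  have hSyi := tendsto_matrix_inv hSy hSy₀
  have hSxi := tendsto_matrix_inv hSx hSx₀
  have hdetY : ∀ᶠ i in l, (Sy i).det ≠ 0 :=
    (((continuous_id.matrix_det).tendsto Sy₀).comp hSy).eventually_ne hSy₀
  have hdetX : ∀ᶠ i in l, (Sx i).det ≠ 0 :=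
    (((continuous_id.matrix_det).tendsto Sx₀).comp hSx).eventually_ne hSx₀
  have hmain := tendsto_bias_expansion hμ hν hM₁ hM₂ hpos hzero θ
    (α := fun k i => eY p μ ⬝ᵥ (Sy i)⁻¹.mulVec (cy k i))
    (β := fun m i => cx m i ⬝ᵥ (Sx i)⁻¹.mulVec (eX q ν))
    (α₀ := fun k => eY p μ ⬝ᵥ Sy₀⁻¹.mulVec (cy₀ k))
    (β₀ := fun m => cx₀ m ⬝ᵥ Sx₀⁻¹.mulVec (eX q ν))
    (fun k hk => tendsto_dotProduct_mulVec tendsto_const_nhds hSyi (hcy k hk))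
    (fun m hm => tendsto_dotProduct_mulVec (hcx m hm) hSxi tendsto_const_nhds)
    (by
      filter_upwards [hdetY] with i hi k hk
      have h1 : cy k i = fun a => Sy i a ⟨k, by omega⟩ :=
        funext fun a => hcyS i ⟨k, by omega⟩ a
      rw [h1, inv_mulVec_col hi]
      simp [eY])
    (by
      filter_upwards [hdetX] with i hi m hm
      have h1 : cx m i = fun b => Sx i ⟨m, mem_multiIdx.2 hm⟩ b :=
        funext fun b => hcxS i ⟨m, mem_multiIdx.2 hm⟩ b
      rw [h1, row_dotProduct_inv_mulVec hi]
      simp [eX])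
    hα' hβ'
  have hE' : Tendsto (fun i => eY p μ ⬝ᵥ ((Sy i)⁻¹ * (Matrix.of fun a b => E i a b / h i ^ M) *
      (Sx i)⁻¹).mulVec (eX q ν)) l (𝓝 0) :=
    tendsto_dotProduct_sandwich hSyi hSxi (fun a b => hE a b) _ _
  -- After division by h^(μ+|ν|) the Taylor error is o(h^(M-μ-|ν|)), and `hM₁` makes that exponent
  -- at least q + 1 - |ν|.
  have hrem := tendsto_pow_div_rate_mul (A := q + 1 - ∑ j, ν j) (B := p + 1 - μ)
    (e := M - (μ + ∑ j, ν j)) hpos hzero (Or.inl (by omega)) hE'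
  have hfin := hmain.add hrem
  rw [add_zero] at hfin
  refine hfin.congr' ?_
  filter_upwards [hR, hpos] with i hRi hi
  have hH : h i ^ (μ + ∑ j, ν j) ≠ 0 := (pow_pos hi _).ne'
  have hRm : R i = (∑ s ∈ degPairs d M, (h i ^ (s.1 + ∑ j, s.2 j) / h i ^ (μ + ∑ j, ν j) *
      θ s.1 s.2) • Matrix.vecMulVec (cy s.1 i) (cx s.2 i)) +
      h i ^ (M - (μ + ∑ j, ν j)) • (Matrix.of fun a b => E i a b / h i ^ M) := by
    ext a b
    rw [pow_sub₀ _ hi.ne' (by omega : μ + ∑ j, ν j ≤ M)]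
    simp only [Matrix.add_apply, Matrix.sum_apply, Matrix.smul_apply, Matrix.vecMulVec_apply,
      Matrix.of_apply, smul_eq_mul]
    have h1 : R i a b = (h i ^ (μ + ∑ j, ν j))⁻¹ * (h i ^ (μ + ∑ j, ν j) * R i a b) := by
      rw [inv_mul_cancel_left₀ hH]
    rw [h1, hRi a b, mul_add, Finset.mul_sum]
    congr 1
    · exact Finset.sum_congr rfl fun s _ => by ring
    · have : h i ^ M ≠ 0 := (pow_pos hi _).ne'
      field_simp
  have hsand : eY p μ ⬝ᵥ ((Sy i)⁻¹ * R i * (Sx i)⁻¹).mulVec (eX q ν) =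
      ∑ s ∈ degPairs d M, h i ^ (s.1 + ∑ j, s.2 j) / h i ^ (μ + ∑ j, ν j) *
        (θ s.1 s.2 * ((eY p μ ⬝ᵥ (Sy i)⁻¹.mulVec (cy s.1 i)) *
          (cx s.2 i ⬝ᵥ (Sx i)⁻¹.mulVec (eX q ν)))) +
      h i ^ (M - (μ + ∑ j, ν j)) * (eY p μ ⬝ᵥ ((Sy i)⁻¹ * (Matrix.of fun a b => E i a b / h i ^ M) *
      (Sx i)⁻¹).mulVec (eX q ν)) := by
    rw [hRm, dotProduct_sandwich_sum]
    simp_rw [mul_assoc]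
  rw [hsand]
  ring

/-! ### Consequences of the kernel assumptions. -/

namespace IsKernelFun

variable {K : ℝ → ℝ} (hK : IsKernelFun K)
include hK

theorem continuous : Continuous K := by
  obtain ⟨C, hC⟩ := hK.lipschitz
  exact hC.continuous

theorem eq_zero_of_one_lt_abs {u : ℝ} (hu : 1 < |u|) : K u = 0 := by
  by_contra h
  have := hK.support h
  exact absurd (abs_le.2 this) (not_le.2 hu)

theorem hasCompactSupport : HasCompactSupport K :=
  HasCompactSupport.of_support_subset_isCompact isCompact_Icc hK.support

/-- A kernel of integral one is positive somewhere, by continuity also at a point other than 0, and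
by symmetry at a point to the right of 0. -/
theorem exists_pos : ∃ u, 0 < u ∧ 0 < K u := by
  have hne : ∃ u, K u ≠ 0 := by
    by_contra! h
    have := hK.integral_one
    simp [h] at this
  obtain ⟨u, hu⟩ := hne
  have hopen : IsOpen {u | 0 < K u} := isOpen_lt continuous_const hK.continuous
  have hu' : 0 < K u := lt_of_le_of_ne (hK.nonneg u) hu.symm
  have : ∃ u, u ≠ 0 ∧ 0 < K u := by
    by_cases h0 : u = 0
    · obtain ⟨ε, hε, hb⟩ := Metric.isOpen_iff.1 hopen u hu'
      refine ⟨ε / 2, by positivity, hb ?_⟩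
      rw [h0, Metric.mem_ball, Real.dist_eq, sub_zero, abs_of_pos (by positivity)]
      linarith
    · exact ⟨u, h0, hu'⟩
  obtain ⟨u, hu0, hu⟩ := this
  rcases lt_or_gt_of_ne hu0 with h | h
  · exact ⟨-u, by linarith, by rwa [hK.symmetric]⟩
  · exact ⟨u, h, hu⟩

theorem continuous_PVec (p : ℕ) (a : Fin (p + 1)) : Continuous fun u => PVec K p u a := by
  have := hK.continuous
  unfold PVec pVec
  fun_prop

theorem PVec_eq_zero {p : ℕ} {a : Fin (p + 1)} {u : ℝ} (hu : 1 < |u|) : PVec K p u a = 0 := by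
  simp [PVec, hK.eq_zero_of_one_lt_abs hu]

theorem hasCompactSupport_PVec (p : ℕ) (a : Fin (p + 1)) :
    HasCompactSupport fun u => PVec K p u a :=
  hK.hasCompactSupport.mul_left

theorem continuous_prodKernel (d : ℕ) : Continuous (prodKernel (d := d) K) := by
  have := hK.continuous
  unfold prodKernel
  fun_prop

theorem prodKernel_eq_zero {d : ℕ} {v : Fin d → ℝ} (hv : 1 < ‖v‖) : prodKernel K v = 0 := by
  obtain ⟨j, hj⟩ : ∃ j, 1 < |v j| := by
    by_contra! h
    exact absurd ((pi_norm_le_iff_of_nonneg zero_le_one).2 h) (not_le.2 hv)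
  exact Finset.prod_eq_zero (Finset.mem_univ j) (hK.eq_zero_of_one_lt_abs hj)

theorem hasCompactSupport_prodKernel (d : ℕ) : HasCompactSupport (prodKernel (d := d) K) := by
  refine HasCompactSupport.of_support_subset_isCompact (isCompact_closedBall 0 1) fun v hv => ?_
  rw [mem_closedBall_zero_iff]
  by_contra h
  exact hv (hK.prodKernel_eq_zero (not_le.1 h))

end IsKernelFun

theorem continuous_mono {d : ℕ} (m : Fin d → ℕ) : Continuous (mono m) := by
  unfold mono
  fun_prop

namespace IsKernelFun

variable {K : ℝ → ℝ} (hK : IsKernelFun K) {d : ℕ}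
include hK

theorem continuous_QVec (q : ℕ) (b : multiIdx d q) : Continuous fun v => QVec K q v b :=
  (continuous_mono b.1).mul (hK.continuous_prodKernel d)

theorem QVec_eq_zero {q : ℕ} {b : multiIdx d q} {v : Fin d → ℝ} (hv : 1 < ‖v‖) :
    QVec K q v b = 0 := by
  simp [QVec, hK.prodKernel_eq_zero hv]

theorem hasCompactSupport_QVec (q : ℕ) (b : multiIdx d q) :
    HasCompactSupport fun v => QVec K q v b :=
  (hK.hasCompactSupport_prodKernel d).mul_left

end IsKernelFun

/-! ### Tangent cones of the unit cube -/

/-- The tangent cone of `[0,1]` at `y`. -/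
def coneY (y : ℝ) : Set ℝ := {v | (y = 0 → 0 ≤ v) ∧ (y = 1 → v ≤ 0)}

/-- The tangent cone of `[0,1]^d` at `x`. -/
def coneX {d : ℕ} (x : Fin d → ℝ) : Set (Fin d → ℝ) := Set.univ.pi fun j => coneY (x j)

theorem measurableSet_coneY (y : ℝ) : MeasurableSet (coneY y) := by
  have : coneY y = {v | y = 0 → 0 ≤ v} ∩ {v | y = 1 → v ≤ 0} := rfl
  rw [this]
  refine MeasurableSet.inter ?_ ?_
  · by_cases h : y = 0
    · simpa only [h, true_imp_iff] using! (measurableSet_Ici : MeasurableSet (Set.Ici (0 : ℝ)))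
    · simp [h]
  · by_cases h : y = 1
    · simpa only [h, true_imp_iff] using! (measurableSet_Iic : MeasurableSet (Set.Iic (0 : ℝ)))
    · simp [h]

theorem measurableSet_coneX {d : ℕ} (x : Fin d → ℝ) : MeasurableSet (coneX x) :=
  MeasurableSet.univ_pi fun j => measurableSet_coneY (x j)

/-- A constraint that is slack at `y` stays slack for small h; an active one only sees the sign of
`v`. How small h must be depends on `v`, which dominated convergence tolerates. -/
theorem eventually_mem_Icc_iff {y : ℝ} (hy : y ∈ Set.Icc (0 : ℝ) 1) (v : ℝ) :
    ∀ᶠ h in 𝓝[>] (0 : ℝ), (y + h * v ∈ Set.Icc (0 : ℝ) 1 ↔ v ∈ coneY y) := by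
  have hc : Tendsto (fun h : ℝ => y + h * v) (𝓝[>] 0) (𝓝 y) :=
    ((by fun_prop : Continuous fun h : ℝ => y + h * v).tendsto' 0 y (by simp)).mono_left
      nhdsWithin_le_nhds
  have h0 : ∀ᶠ h in 𝓝[>] (0 : ℝ), (0 ≤ y + h * v ↔ (y = 0 → 0 ≤ v)) := by
    rcases eq_or_lt_of_le hy.1 with h | h
    · filter_upwards [self_mem_nhdsWithin] with t ht
      have ht' : (0 : ℝ) < t := ht
      simp [← h, mul_nonneg_iff_of_pos_left ht']
    · filter_upwards [hc.eventually_const_lt h] with t ht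
      simp [ht.le, h.ne']
  have h1 : ∀ᶠ h in 𝓝[>] (0 : ℝ), (y + h * v ≤ 1 ↔ (y = 1 → v ≤ 0)) := by
    rcases eq_or_lt_of_le hy.2 with h | h
    · filter_upwards [self_mem_nhdsWithin] with t ht
      have ht' : (0 : ℝ) < t := ht
      simp only [h, true_imp_iff]
      constructor
      · intro hle
        by_contra hv
        have := mul_pos ht' (not_le.1 hv)
        linarith
      · intro hv
        have := mul_nonpos_of_nonneg_of_nonpos ht'.le hv
        linarith
    · filter_upwards [hc.eventually_lt_const h] with t ht
      simp [ht.le, h.ne]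
  filter_upwards [h0, h1] with t ht0 ht1
  exact and_congr ht0 ht1

theorem mem_Icc_pi_iff {d : ℕ} {z : Fin d → ℝ} :
    z ∈ Set.Icc (0 : Fin d → ℝ) 1 ↔ ∀ j, z j ∈ Set.Icc (0 : ℝ) 1 :=
  ⟨fun h j => ⟨h.1 j, h.2 j⟩, fun h => ⟨fun j => (h j).1, fun j => (h j).2⟩⟩

theorem eventually_mem_cube_iff {d : ℕ} {x : Fin d → ℝ} (hx : x ∈ Set.Icc (0 : Fin d → ℝ) 1)
    (v : Fin d → ℝ) :
    ∀ᶠ h in 𝓝[>] (0 : ℝ), (x + h • v ∈ Set.Icc (0 : Fin d → ℝ) 1 ↔ v ∈ coneX x) := by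
  filter_upwards [eventually_all.2 fun j => eventually_mem_Icc_iff (mem_Icc_pi_iff.1 hx j) (v j)]
    with h hh
  rw [mem_Icc_pi_iff, coneX, Set.mem_univ_pi]
  exact forall_congr' fun j => hh j

/-- The cone contains a half-line, to the left if y = 1 and to the right otherwise, and the
symmetric kernel is positive somewhere on either side. So the Gram matrix stays nondegenerate at the
boundary. -/
theorem exists_interior_coneY {K : ℝ → ℝ} (hK : IsKernelFun K) (y : ℝ) :
    ∃ v₀, ∀ᶠ v in 𝓝 v₀, v ∈ coneY y ∧ 0 < K v := by
  obtain ⟨u, hu, hKu⟩ := hK.exists_pos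
  by_cases h : y = 1
  · refine ⟨-u, ?_⟩
    filter_upwards [hK.continuous.continuousAt.eventually_const_lt (show 0 < K (-u) by
      rwa [hK.symmetric]), eventually_lt_nhds (show -u < 0 by linarith)] with v hv hv0
    exact ⟨⟨fun h0 => absurd (h0.symm.trans h) (by norm_num), fun _ => hv0.le⟩, hv⟩
  · refine ⟨u, ?_⟩
    filter_upwards [hK.continuous.continuousAt.eventually_const_lt hKu, eventually_gt_nhds hu]
      with v hv hv0
    exact ⟨⟨fun _ => hv0.le, fun h1 => absurd h1 h⟩, hv⟩

theorem exists_interior_coneX {K : ℝ → ℝ} (hK : IsKernelFun K) {d : ℕ} (x : Fin d → ℝ) :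
    ∃ v₀, ∀ᶠ v in 𝓝 v₀, v ∈ coneX x ∧ 0 < prodKernel K v := by
  choose v₀ hv₀ using fun j => exists_interior_coneY hK (x j)
  refine ⟨v₀, ?_⟩
  have : ∀ᶠ v in 𝓝 v₀, ∀ j, v j ∈ coneY (x j) ∧ 0 < K (v j) :=
    eventually_all.2 fun j => ((continuous_apply j).tendsto v₀).eventually (hv₀ j)
  filter_upwards [this] with v hv
  exact ⟨fun j _ => (hv j).1, Finset.prod_pos fun j _ => (hv j).2⟩

/-! ### Limits of the moment matrices, up to the value of the density -/

/-- `∫ u^k/k! P(u) du` over the tangent cone. -/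
noncomputable def limY (K : ℝ → ℝ) (p : ℕ) (y : ℝ) (k : ℕ) : Fin (p + 1) → ℝ :=
  fun a => ∫ u in coneY y, u ^ k / (k.factorial : ℝ) * PVec K p u a

/-- `∫ v^m/m! Q(v) dv` over the tangent cone. -/
noncomputable def limX {d : ℕ} (K : ℝ → ℝ) (q : ℕ) (x : Fin d → ℝ) (m : Fin d → ℕ) : multiIdx d q → ℝ :=
  fun b => ∫ v in coneX x, mono m v * QVec K q v b

/-- `∫ p(u) P(u)ᵀ du` over the tangent cone. -/
noncomputable def limSY (K : ℝ → ℝ) (p : ℕ) (y : ℝ) : Matrix (Fin (p + 1)) (Fin (p + 1)) ℝ :=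
  Matrix.of fun a b => ∫ u in coneY y, pVec p u a * PVec K p u b

/-- `∫ q(v) Q(v)ᵀ dv` over the tangent cone. -/
noncomputable def limSX {d : ℕ} (K : ℝ → ℝ) (q : ℕ) (x : Fin d → ℝ) :
    Matrix (multiIdx d q) (multiIdx d q) ℝ :=
  Matrix.of fun a b => ∫ v in coneX x, qVec q v a * QVec K q v b

theorem det_limSY_ne_zero {K : ℝ → ℝ} (hK : IsKernelFun K) (p : ℕ) (y : ℝ) :
    (limSY K p y).det ≠ 0 := by
  obtain ⟨v₀, hv₀⟩ := exists_interior_coneY hK y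
  refine det_gram_ne_zero volume (b := fun a u => pVec p u a) (fun a => ?_) hK.continuous
    hK.hasCompactSupport hK.nonneg hv₀ fun c hc => eq_zero_of_eventually_pVec hc
  unfold pVec
  fun_prop

theorem det_limSX_ne_zero {K : ℝ → ℝ} (hK : IsKernelFun K) {d : ℕ} (q : ℕ) (x : Fin d → ℝ) :
    (limSX K q x).det ≠ 0 := by
  obtain ⟨v₀, hv₀⟩ := exists_interior_coneX hK x
  exact det_gram_ne_zero volume (b := fun a v => qVec q v a) (fun a => continuous_mono a.1)
    (hK.continuous_prodKernel d) (hK.hasCompactSupport_prodKernel d)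
    (fun v => Finset.prod_nonneg fun j _ => hK.nonneg (v j)) hv₀
    fun c hc => eq_zero_of_eventually_qVec hc

theorem limSY_transpose (K : ℝ → ℝ) (p : ℕ) (y : ℝ) : (limSY K p y).transpose = limSY K p y := by
  ext a b
  simp only [limSY, Matrix.transpose_apply, Matrix.of_apply, PVec]
  congr 1; ext u; ring

/-! ### Marginal densities and laws -/

section Marginal

variable {A B : Type*} [TopologicalSpace A] [TopologicalSpace B] [FirstCountableTopology B]
  [MeasurableSpace A] [OpensMeasurableSpace A] [T2Space A] [SecondCountableTopologyEither A ℝ]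
  {vol : Measure A} [IsFiniteMeasureOnCompacts vol] {CA : Set A} {CB : Set B} {f : A → B → ℝ}

theorem continuousOn_setIntegral (hCA : IsCompact CA) (hCB : IsCompact CB)
    (hf : ContinuousOn (fun z : A × B => f z.1 z.2) (CA ×ˢ CB)) :
    ContinuousOn (fun b => ∫ a in CA, f a b ∂vol) CB := by
  obtain ⟨M, hM⟩ := (hCA.prod hCB).exists_bound_of_continuousOn hf
  have : IsFiniteMeasure (vol.restrict CA) := ⟨by simpa using hCA.measure_lt_top⟩
  intro b hb
  refine continuousWithinAt_of_dominated (bound := fun _ => M) ?_ ?_ (integrable_const M) ?_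
  · filter_upwards [self_mem_nhdsWithin] with b' hb'
    exact (hf.comp (f := fun a => (a, b')) (by fun_prop)
      fun a ha => ⟨ha, hb'⟩).aestronglyMeasurable hCA.measurableSet
  · filter_upwards [self_mem_nhdsWithin] with b' hb'
    filter_upwards [ae_restrict_mem hCA.measurableSet] with a ha
    exact hM (a, b') ⟨ha, hb'⟩
  · filter_upwards [ae_restrict_mem hCA.measurableSet] with a ha
    exact (hf (a, b) ⟨ha, hb⟩).comp (f := fun b' => (a, b')) (by fun_prop)
      fun b' hb' => ⟨ha, hb'⟩

end Marginal

/-- The marginal density of the response on `[0,1]`. -/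
noncomputable def marginalY {d : ℕ} (f : ℝ → (Fin d → ℝ) → ℝ) (y : ℝ) : ℝ :=
  ∫ x in Set.Icc (0 : Fin d → ℝ) 1, f y x

namespace IsDGP

variable {Ω : Type*} [MeasurableSpace Ω] {P : Measure Ω} {d : ℕ} {Y : ℕ → Ω → ℝ}
  {X : ℕ → Ω → Fin d → ℝ} {f : ℝ → (Fin d → ℝ) → ℝ} (hD : IsDGP P Y X f)
include hD

theorem continuousOn_marginalX : ContinuousOn (marginalX f) (Set.Icc 0 1) :=
  continuousOn_setIntegral isCompact_Icc isCompact_Icc hD.density_continuous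

theorem continuousOn_marginalY : ContinuousOn (marginalY f) (Set.Icc 0 1) :=
  continuousOn_setIntegral (f := fun x y => f y x) isCompact_Icc isCompact_Icc
    (hD.density_continuous.comp (f := Prod.swap) continuous_swap.continuousOn
      fun _ hz => ⟨hz.2, hz.1⟩)

theorem continuousOn_left {x : Fin d → ℝ} (hx : x ∈ Set.Icc (0 : Fin d → ℝ) 1) :
    ContinuousOn (fun y => f y x) (Set.Icc 0 1) :=
  hD.density_continuous.comp (f := fun y => (y, x)) (by fun_prop) fun _ hy => ⟨hy, hx⟩

theorem continuousOn_right {y : ℝ} (hy : y ∈ Set.Icc (0 : ℝ) 1) :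
    ContinuousOn (f y) (Set.Icc 0 1) :=
  hD.density_continuous.comp (f := fun x => (y, x)) (by fun_prop) fun _ hx => ⟨hy, hx⟩

theorem marginalX_pos {x : Fin d → ℝ} (hx : x ∈ Set.Icc (0 : Fin d → ℝ) 1) :
    0 < marginalX f x := by
  obtain ⟨c, hc, hcf⟩ := hD.density_lower
  refine hc.trans_le ?_
  have h1 : ∫ _ in Set.Icc (0 : ℝ) 1, c = c := by simp
  rw [← h1]
  exact setIntegral_mono_on (integrableOn_const (by simp))
    ((hD.continuousOn_left hx).integrableOn_compact isCompact_Icc) measurableSet_Icc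
    fun y hy => hcf y hy x hx

theorem marginalY_pos {y : ℝ} (hy : y ∈ Set.Icc (0 : ℝ) 1) : 0 < marginalY f y := by
  obtain ⟨c, hc, hcf⟩ := hD.density_lower
  refine hc.trans_le ?_
  have h1 : ∫ _ in Set.Icc (0 : Fin d → ℝ) 1, c = c := by
    rw [setIntegral_const, measureReal_def, Real.volume_Icc_pi]
    simp
  rw [← h1]
  exact setIntegral_mono_on (integrableOn_const (by rw [Real.volume_Icc_pi]; simp))
    ((hD.continuousOn_right hy).integrableOn_compact isCompact_Icc) measurableSet_Icc
    fun x hx => hcf y hy x hx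

/-- The lower bound on the density makes `ENNReal.ofReal` lossless on the cube, and continuity there
supplies the measurability. -/
theorem integral_law {i : ℕ} {F : ℝ × (Fin d → ℝ) → ℝ} (hF : Continuous F) :
    ∫ ω, F (Y i ω, X i ω) ∂P =
      ∫ z in Set.Icc (0 : ℝ) 1 ×ˢ Set.Icc (0 : Fin d → ℝ) 1, f z.1 z.2 * F z := by
  have hm : MeasurableSet (Set.Icc (0 : ℝ) 1 ×ˢ Set.Icc (0 : Fin d → ℝ) 1) :=
    measurableSet_Icc.prod measurableSet_Icc
  have h1 := integral_map (μ := P) (φ := fun ω => (Y i ω, X i ω))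
    ((hD.measurable_Y i).prodMk (hD.measurable_X i)).aemeasurable
    (f := F) hF.aestronglyMeasurable
  rw [← h1, hD.law i, integral_withDensity_eq_integral_toReal_smul₀
    (hD.density_continuous.aemeasurable hm).ennreal_ofReal (by simp)]
  refine setIntegral_congr_fun hm fun z hz => ?_
  obtain ⟨c, hc, hcf⟩ := hD.density_lower
  simp only [smul_eq_mul]
  rw [ENNReal.toReal_ofReal (hc.le.trans (hcf _ hz.1 _ hz.2))]

theorem integrable_mul {F : ℝ × (Fin d → ℝ) → ℝ} (hF : Continuous F) :
    Integrable (fun z : ℝ × (Fin d → ℝ) => f z.1 z.2 * F z)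
      ((volume.restrict (Set.Icc (0 : ℝ) 1)).prod
        (volume.restrict (Set.Icc (0 : Fin d → ℝ) 1))) := by
  rw [Measure.prod_restrict, ← Measure.volume_eq_prod]
  exact (hD.density_continuous.mul hF.continuousOn).integrableOn_compact
    (isCompact_Icc.prod isCompact_Icc)

theorem integral_X {i : ℕ} {F : (Fin d → ℝ) → ℝ} (hF : Continuous F) :
    ∫ ω, F (X i ω) ∂P = ∫ x in Set.Icc (0 : Fin d → ℝ) 1, F x * marginalX f x := by
  rw [hD.integral_law (F := fun z => F z.2) (by fun_prop), Measure.volume_eq_prod,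
    ← Measure.prod_restrict, integral_prod_symm _ (hD.integrable_mul (by fun_prop))]
  congr 1
  ext x
  exact (integral_mul_const (F x) fun u => f u x).trans (mul_comm _ _)

theorem integral_Y {i : ℕ} {F : ℝ → ℝ} (hF : Continuous F) :
    ∫ ω, F (Y i ω) ∂P = ∫ y in Set.Icc (0 : ℝ) 1, F y * marginalY f y := by
  rw [hD.integral_law (F := fun z => F z.1) (by fun_prop), Measure.volume_eq_prod,
    ← Measure.prod_restrict, integral_prod _ (hD.integrable_mul (by fun_prop))]
  congr 1
  ext x
  exact (integral_mul_const (F x) fun u => f x u).trans (mul_comm _ _)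

theorem iIndepFun_X : iIndepFun X P :=
  hD.indep.comp (fun _ => Prod.snd) fun _ => measurable_snd

theorem iIndepFun_Y : iIndepFun Y P :=
  hD.indep.comp (fun _ => Prod.fst) fun _ => measurable_fst

theorem map_X (i : ℕ) : P.map (X i) = P.map (X 0) := by
  have h : ∀ i, P.map (X i) = (P.map fun ω => (Y i ω, X i ω)).map Prod.snd := fun i =>
    (Measure.map_map measurable_snd ((hD.measurable_Y i).prodMk (hD.measurable_X i))).symm
  rw [h, h, hD.law, hD.law]

theorem map_Y (i : ℕ) : P.map (Y i) = P.map (Y 0) := by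
  have h : ∀ i, P.map (Y i) = (P.map fun ω => (Y i ω, X i ω)).map Prod.fst := fun i =>
    (Measure.map_map measurable_fst ((hD.measurable_Y i).prodMk (hD.measurable_X i))).symm
  rw [h, h, hD.law, hD.law]

theorem ae_mem (i : ℕ) :
    ∀ᵐ ω ∂P, Y i ω ∈ Set.Icc (0 : ℝ) 1 ∧ X i ω ∈ Set.Icc (0 : Fin d → ℝ) 1 := by
  have hm : MeasurableSet (Set.Icc (0 : ℝ) 1 ×ˢ Set.Icc (0 : Fin d → ℝ) 1) :=
    measurableSet_Icc.prod measurableSet_Icc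
  have h1 : ∀ᵐ z ∂(P.map fun ω => (Y i ω, X i ω)),
      z ∈ Set.Icc (0 : ℝ) 1 ×ˢ Set.Icc (0 : Fin d → ℝ) 1 := by
    rw [hD.law i]
    exact (withDensity_absolutelyContinuous _ _).ae_le (ae_restrict_mem hm)
  exact ae_of_ae_map ((hD.measurable_Y i).prodMk (hD.measurable_X i)).aemeasurable h1

end IsDGP

/-! ### Limits of population and sample kernel averages -/

/-- Law of large numbers for rescaled kernel averages at `x`, in terms of the tangent cone `D`. -/
theorem tendstoInMeasure_rescaled_average {E : Type*} [NormedAddCommGroup E] [NormedSpace ℝ E]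
    [FiniteDimensional ℝ E] [MeasurableSpace E] [BorelSpace E] (vol : Measure E)
    [vol.IsAddHaarMeasure] {Ω : Type*} [MeasurableSpace Ω] {P : Measure Ω}
    [IsProbabilityMeasure P] {Z : ℕ → Ω → E} (hZ : ∀ i, Measurable (Z i)) (hind : iIndepFun Z P)
    (hlaw : ∀ i, P.map (Z i) = P.map (Z 0)) {C D : Set E} (hC : IsCompact C)
    (hD : MeasurableSet D) {x : E} (hx : x ∈ C)
    (hCD : ∀ v, ∀ᶠ h in 𝓝[>] (0 : ℝ), (x + h • v ∈ C ↔ v ∈ D)) {w : E → ℝ}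
    (hw : ContinuousOn w C)
    (hdens : ∀ F : E → ℝ, Continuous F → ∫ ω, F (Z 0 ω) ∂P = ∫ s in C, F s * w s ∂vol)
    {φ : E → ℝ} (hφ : Continuous φ) (hφs : HasCompactSupport φ) {h : ℕ → ℝ} (hpos : ∀ n, 0 < h n)
    (hzero : Tendsto h atTop (𝓝 0))
    (hrate : Tendsto (fun n : ℕ => (n : ℝ) * h n ^ Module.finrank ℝ E) atTop atTop) :
    TendstoInMeasure P (fun (n : ℕ) ω => 1 / ((n : ℝ) * h n ^ Module.finrank ℝ E) *
      ∑ i ∈ Finset.range n, φ ((h n)⁻¹ • (Z i ω - x))) atTop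
      (fun _ => w x * ∫ v in D, φ v ∂vol) := by
  have hh : Tendsto h atTop (𝓝[>] 0) :=
    tendsto_nhdsWithin_iff.2 ⟨hzero, Eventually.of_forall hpos⟩
  -- Stated for a general test function because the law of large numbers needs both φ and |φ|.
  have key : ∀ χ : E → ℝ, Continuous χ → HasCompactSupport χ →
      Tendsto (fun n => (∫ z, χ ((h n)⁻¹ • (z - x)) ∂(P.map (Z 0))) / h n ^ Module.finrank ℝ E)
        atTop (𝓝 (w x * ∫ v in D, χ v ∂vol)) := by
    intro χ hχ hχs
    refine ((tendsto_setIntegral_rescaled vol hC hD hx hCD hw hχ hχs).comp hh).congr fun n => ?_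
    have hcont : Continuous fun z => χ ((h n)⁻¹ • (z - x)) := by fun_prop
    rw [integral_map (hZ 0).aemeasurable hcont.aestronglyMeasurable, hdens _ hcont,
      setIntegral_eq_rescaled vol hC.measurableSet _ x (hpos n)]
    have hn := (hpos n).ne'
    rw [mul_div_cancel_left₀ _ (pow_ne_zero _ hn)]
    simp [smul_smul, hn]
  obtain ⟨M, hM⟩ := hφs.exists_bound_of_continuous hφ
  exact tendstoInMeasure_kernel_average hZ hind hlaw
    (ψ := fun n z => φ ((h n)⁻¹ • (z - x))) (fun n => by fun_prop) (fun n z => hM _)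
    (fun n => pow_pos (hpos n) _) hrate (key φ hφ hφs) (key (fun v => |φ v|) hφ.abs hφs.norm)

/-! ### Limits of the population moments -/

section Population

variable {K G : ℝ → ℝ} (hK : IsKernelFun K) {y : ℝ} (hy : y ∈ Set.Icc (0 : ℝ) 1)
include hK hy

omit hK in
theorem tendsto_setIntegral_Icc {w : ℝ → ℝ} (hw : ContinuousOn w (Set.Icc 0 1)) {φ : ℝ → ℝ}
    (hφ : Continuous φ) (hφs : HasCompactSupport φ) :
    Tendsto (fun h : ℝ => ∫ u in {u : ℝ | y + h * u ∈ Set.Icc (0 : ℝ) 1}, φ u * w (y + h * u))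
      (𝓝[>] 0) (𝓝 (w y * ∫ u in coneY y, φ u)) :=
  tendsto_setIntegral_rescaled volume isCompact_Icc (measurableSet_coneY y) hy
    (eventually_mem_Icc_iff hy) hw hφ hφs

theorem tendsto_cY (hg : ContinuousOn (weightDensity G) (Set.Icc 0 1)) (p k : ℕ) :
    Tendsto (fun h => cY K G p k h y) (𝓝[>] 0) (𝓝 (weightDensity G y • limY K p y k)) :=
  tendsto_pi_nhds.2 fun a => tendsto_setIntegral_Icc hy hg
    (((continuous_pow k).div_const _).mul (hK.continuous_PVec p a))
    (hK.hasCompactSupport_PVec p a).mul_left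

omit hK hy in
theorem SY_eq_cY (p : ℕ) (h : ℝ) (a b : Fin (p + 1)) : SY K G p h y a b = cY K G p b h y a := by
  simp only [SY, cY, Matrix.of_apply, PVec, pVec]
  congr 1; ext u; ring

omit hK hy in
theorem limSY_eq_limY (p : ℕ) (a b : Fin (p + 1)) : limSY K p y a b = limY K p y b a := by
  simp only [limSY, limY, Matrix.of_apply, PVec, pVec]
  congr 1; ext u; ring

theorem tendsto_SY (hg : ContinuousOn (weightDensity G) (Set.Icc 0 1)) (p : ℕ) :
    Tendsto (fun h => SY K G p h y) (𝓝[>] 0) (𝓝 (weightDensity G y • limSY K p y)) := by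
  refine tendsto_pi_nhds.2 fun a => tendsto_pi_nhds.2 fun b => ?_
  simp_rw [SY_eq_cY]
  rw [Matrix.smul_apply, limSY_eq_limY]
  exact tendsto_pi_nhds.1 (tendsto_cY hK hy hg p b) a

omit hy in
theorem tendsto_cX {d : ℕ} {f : ℝ → (Fin d → ℝ) → ℝ} {x : Fin d → ℝ}
    (hx : x ∈ Set.Icc (0 : Fin d → ℝ) 1) (hw : ContinuousOn (marginalX f) (Set.Icc 0 1)) (q : ℕ)
    (m : Fin d → ℕ) :
    Tendsto (fun h => cX K f q m h x) (𝓝[>] 0) (𝓝 (marginalX f x • limX K q x m)) :=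
  tendsto_pi_nhds.2 fun b => tendsto_setIntegral_rescaled volume isCompact_Icc
    (measurableSet_coneX x) hx (eventually_mem_cube_iff hx) hw
    ((continuous_mono m).mul (hK.continuous_QVec q b)) (hK.hasCompactSupport_QVec q b).mul_left

omit hy in
theorem tendsto_SX {d : ℕ} {f : ℝ → (Fin d → ℝ) → ℝ} {x : Fin d → ℝ}
    (hx : x ∈ Set.Icc (0 : Fin d → ℝ) 1) (hw : ContinuousOn (marginalX f) (Set.Icc 0 1)) (q : ℕ) :
    Tendsto (fun h => SX K f q h x) (𝓝[>] 0) (𝓝 (marginalX f x • limSX K q x)) :=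
  tendsto_pi_nhds.2 fun a => tendsto_pi_nhds.2 fun b =>
    tendsto_pi_nhds.1 (tendsto_cX hK hx hw q a.1) b

end Population

/-! ### Cancellation of the density factor. -/

section Scaling

variable {κ : Type*} [Fintype κ] [DecidableEq κ]

theorem smul_dotProduct_inv_smul {S : Matrix κ κ ℝ} (hS : S.det ≠ 0) {r : ℝ} (hr : r ≠ 0)
    (c u : κ → ℝ) : (r • c) ⬝ᵥ (r • S)⁻¹.mulVec u = c ⬝ᵥ S⁻¹.mulVec u := by
  have : (r • S)⁻¹ = r⁻¹ • S⁻¹ := by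
    let _ := invertibleOfNonzero hr
    rw [Matrix.inv_smul S r (isUnit_iff_ne_zero.2 hS), invOf_eq_inv]
  rw [this, Matrix.smul_mulVec, smul_dotProduct, dotProduct_smul, smul_smul, mul_inv_cancel₀ hr,
    one_smul]

/-- The scale of the density cancels, and symmetry of S exchanges the two sides. This matches the
coefficient met in the sandwich with the transposed form used in the leading bias. -/
theorem dotProduct_inv_smul_smul {S : Matrix κ κ ℝ} (hS : S.det ≠ 0) (hST : S.transpose = S)
    {r : ℝ} (hr : r ≠ 0) (c u : κ → ℝ) :
    u ⬝ᵥ (r • S)⁻¹.mulVec (r • c) = c ⬝ᵥ S⁻¹.mulVec u := by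
  rw [← smul_dotProduct_inv_smul hS hr c u, Matrix.dotProduct_mulVec, ← Matrix.mulVec_transpose,
    Matrix.transpose_nonsing_inv, Matrix.transpose_smul, hST, dotProduct_comm]

theorem det_smul_ne_zero {S : Matrix κ κ ℝ} (hS : S.det ≠ 0) {r : ℝ} (hr : r ≠ 0) :
    (r • S).det ≠ 0 := by
  rw [Matrix.det_smul]
  exact mul_ne_zero (pow_ne_zero _ hr) hS

end Scaling

/-! ### Taylor expansion of the conditional distribution function -/

section Taylor

variable {d : ℕ} {f : ℝ → (Fin d → ℝ) → ℝ}

theorem sum_multiIdx_succ (M : ℕ) (T : (Fin (d + 1) → ℕ) → ℝ) :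
    ∑ m ∈ multiIdx (d + 1) M, T m = ∑ s ∈ degPairs d M, T (Fin.cons s.1 s.2) := by
  refine Finset.sum_bij' (fun m _ => (m 0, Fin.tail m)) (fun s _ => Fin.cons s.1 s.2) ?_ ?_ ?_ ?_ ?_
  · intro m hm
    rw [mem_multiIdx, Fin.sum_univ_succ] at hm
    exact mem_degPairs.2 hm
  · intro s hs
    rw [mem_degPairs] at hs
    rw [mem_multiIdx, Fin.sum_univ_succ]
    simpa using hs
  · intro m _
    exact Fin.cons_self_tail m
  · intro s _
    simp
  · intro m _
    rw [Fin.cons_self_tail]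

theorem mono_cons (k : ℕ) (m : Fin d → ℕ) (u : ℝ) (v : Fin d → ℝ) :
    mono (Fin.cons k m : Fin (d + 1) → ℕ) (Fin.cons u v : Fin (d + 1) → ℝ) =
      u ^ k / (k.factorial : ℝ) * mono m v := by
  simp only [mono, Fin.prod_univ_succ, Fin.cons_zero, Fin.cons_succ]

theorem mono_smul (m : Fin d → ℕ) (h : ℝ) (v : Fin d → ℝ) :
    mono m (h • v) = h ^ (∑ j, m j) * mono m v := by
  simp only [mono, Pi.smul_apply, smul_eq_mul, mul_pow, ← Finset.prod_pow_eq_pow_sum,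
    ← Finset.prod_mul_distrib, mul_div_assoc]

theorem cons_mem_cube {s : ℝ} {w : Fin d → ℝ} (hs : s ∈ Set.Icc (0 : ℝ) 1)
    (hw : w ∈ Set.Icc (0 : Fin d → ℝ) 1) :
    (Fin.cons s w : Fin (d + 1) → ℝ) ∈ Set.Icc (0 : Fin (d + 1) → ℝ) 1 := by
  rw [mem_Icc_pi_iff] at hw ⊢
  intro j
  refine Fin.cases ?_ (fun j => ?_) j
  · simpa using hs
  · simpa using hw j

/-- Uniform Taylor expansion of `F(s | w)` on a window of size `h` around `(y, x)`. -/
theorem condCDF_taylor {M : ℕ} (hsmooth : ∀ (μ' : ℕ) (ν' : Fin d → ℕ), μ' + ∑ j, ν' j = M →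
      ThetaExistsContinuous f μ' ν') {y : ℝ} (hy : y ∈ Set.Icc (0 : ℝ) 1) {x : Fin d → ℝ}
    (hx : x ∈ Set.Icc (0 : Fin d → ℝ) 1) {ε : ℝ} (hε : 0 < ε) :
    ∃ δ > 0, ∀ h : ℝ, 0 < h → h ≤ δ → ∀ s ∈ Set.Icc (0 : ℝ) 1, ∀ w ∈ Set.Icc (0 : Fin d → ℝ) 1,
      |(s - y) / h| ≤ 1 → ‖scaled h x w‖ ≤ 1 →
        |condCDF f s w - ∑ t ∈ degPairs d M, h ^ (t.1 + ∑ j, t.2 j) * theta f t.1 t.2 y x *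
          (((s - y) / h) ^ t.1 / (t.1.factorial : ℝ) * mono t.2 (scaled h x w))| ≤ ε * h ^ M := by
  have ha := cons_mem_cube hy hx
  obtain ⟨δ, hδ, hT⟩ := taylor_cube ha (L := M) (Φ := condCDFJoint f) (fun m hm => by
    have h1 := hsmooth (m 0) (Fin.tail m) (by rw [← hm, Fin.sum_univ_succ]; rfl)
    rw [ThetaExistsContinuous, Fin.cons_self_tail] at h1
    refine ⟨h1.1, ?_⟩
    have h2 := h1.2 (y, x) ⟨hy, hx⟩
    have h3 : ContinuousWithinAt (fun z : Fin (d + 1) → ℝ => (z 0, Fin.tail z)) (Set.Icc 0 1)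
        (Fin.cons y x) := by
      refine Continuous.continuousWithinAt ?_
      unfold Fin.tail
      fun_prop
    have h4 := ContinuousWithinAt.comp (t := Set.Icc (0 : ℝ) 1 ×ˢ Set.Icc (0 : Fin d → ℝ) 1)
      (f := fun z : Fin (d + 1) → ℝ => (z 0, Fin.tail z)) (x := Fin.cons y x)
      (by simpa using h2) h3 (fun z hz => by
        rw [mem_Icc_pi_iff] at hz
        exact ⟨hz 0, mem_Icc_pi_iff.2 fun j => hz j.succ⟩)
    refine h4.congr_of_eventuallyEq (Eventually.of_forall fun z => ?_) ?_ <;>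
    · simp only [Function.comp, theta, Fin.cons_self_tail]) hε
  refine ⟨δ, hδ, fun h hh hhδ s hs w hw hu hv => ?_⟩
  have hz : (Fin.cons s w : Fin (d + 1) → ℝ) - Fin.cons y x =
      h • (Fin.cons ((s - y) / h) (scaled h x w) : Fin (d + 1) → ℝ) := by
    ext j
    refine Fin.cases ?_ (fun j => ?_) j
    · simp only [Pi.sub_apply, Pi.smul_apply, Fin.cons_zero, smul_eq_mul]
      field_simp
    · simp only [Pi.sub_apply, Pi.smul_apply, Fin.cons_succ, smul_eq_mul, scaled]
      field_simp
  -- In the sup norm the window of size h is the ball of radius h, so the error o(‖z - a‖^M) becomes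
  -- o(h^M) uniformly over it.
  have hn : ‖(Fin.cons s w : Fin (d + 1) → ℝ) - Fin.cons y x‖ ≤ h := by
    rw [hz, norm_smul, Real.norm_of_nonneg hh.le]
    refine mul_le_of_le_one_right hh.le ((pi_norm_le_iff_of_nonneg zero_le_one).2 fun j => ?_)
    refine Fin.cases ?_ (fun j => ?_) j
    · simpa only [Fin.cons_zero, Real.norm_eq_abs] using hu
    · simpa using (norm_le_pi_norm _ j).trans hv
  have h1 := hT _ (cons_mem_cube hs hw) (hn.trans hhδ)
  have h2 : ε * ‖(Fin.cons s w : Fin (d + 1) → ℝ) - Fin.cons y x‖ ^ M ≤ ε * h ^ M :=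
    mul_le_mul_of_nonneg_left (pow_le_pow_left₀ (norm_nonneg _) hn _) hε.le
  refine le_trans (le_of_eq ?_) (h1.trans h2)
  rw [sum_multiIdx_succ, hz]
  have h3 : condCDFJoint f (Fin.cons s w : Fin (d + 1) → ℝ) = condCDF f s w := by
    simp [condCDFJoint]
  rw [h3]
  congr 2
  refine Finset.sum_congr rfl fun t _ => ?_
  rw [mono_smul, mono_cons, theta, Fin.sum_univ_succ]
  simp only [Fin.cons_zero, Fin.cons_succ]
  ring

theorem continuousOn_condCDF {w : Fin d → ℝ}
    (hf : ContinuousOn (fun u => f u w) (Set.Icc 0 1)) :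
    ContinuousOn (fun s => condCDF f s w) (Set.Icc 0 1) :=
  intervalIntegral.continuousOn_primitive_Icc
    ((hf.div_const _).integrableOn_compact isCompact_Icc)

end Taylor

/-! ### Expansion of the bracketed matrices. -/

/-- Only indices with nonzero weight matter, so an approximation valid inside the kernel window
suffices. -/
theorem abs_weighted_sum_sub_le {σ τ : Type*} {N : Finset σ} {S : Finset τ} {φ w : σ → ℝ}
    {C : τ → ℝ} {b : τ → σ → ℝ} {B c : ℝ} (hc : 0 ≤ c)
    (hφ : ∀ i ∈ N, w i ≠ 0 → |φ i - ∑ t ∈ S, C t * b t i| ≤ B) :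
    |c * ∑ i ∈ N, φ i * w i - ∑ t ∈ S, C t * (c * ∑ i ∈ N, b t i * w i)| ≤
      B * (c * ∑ i ∈ N, |w i|) := by
  have h1 : c * ∑ i ∈ N, φ i * w i - ∑ t ∈ S, C t * (c * ∑ i ∈ N, b t i * w i) =
      c * ∑ i ∈ N, (φ i - ∑ t ∈ S, C t * b t i) * w i := by
    simp_rw [sub_mul, Finset.sum_sub_distrib, mul_sub, Finset.sum_mul, Finset.mul_sum]
    congr 1
    rw [Finset.sum_comm]
    exact Finset.sum_congr rfl fun i _ => Finset.sum_congr rfl fun t _ => by ring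
  rw [h1, abs_mul, abs_of_nonneg hc, mul_left_comm, Finset.mul_sum]
  refine mul_le_mul_of_nonneg_left ((Finset.abs_sum_le_sum_abs _ _).trans
    (Finset.sum_le_sum fun i hi => ?_)) hc
  rw [abs_mul]
  by_cases hw : w i = 0
  · simp [hw]
  · exact mul_le_mul_of_nonneg_right (hφ i hi hw) (abs_nonneg _)

theorem abs_setIntegral_sub_le {τ : Type*} {S : Finset τ} {D : Set ℝ} (hD : IsCompact D)
    {φ w : ℝ → ℝ} (hφ : ContinuousOn φ D) (hw : ContinuousOn w D) {C : τ → ℝ} {b : τ → ℝ → ℝ}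
    (hb : ∀ t, Continuous (b t)) {B : ℝ}
    (h : ∀ u ∈ D, w u ≠ 0 → |φ u - ∑ t ∈ S, C t * b t u| ≤ B) :
    |(∫ u in D, φ u * w u) - ∑ t ∈ S, C t * ∫ u in D, b t u * w u| ≤ B * ∫ u in D, |w u| := by
  have hi : ∀ t, IntegrableOn (fun u => C t * (b t u * w u)) D := fun t =>
    (((hb t).continuousOn.mul hw).integrableOn_compact hD).const_mul _
  have hφw : IntegrableOn (fun u => φ u * w u) D := (hφ.mul hw).integrableOn_compact hD
  simp_rw [← integral_const_mul]
  rw [← integral_finsetSum _ fun t _ => hi t, ← integral_sub hφw (integrable_finsetSum _ fun t _ => hi t)]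
  refine (abs_integral_le_integral_abs).trans (setIntegral_mono_on ?_ ?_ hD.measurableSet ?_)
  · exact (hφw.sub (integrable_finsetSum _ fun t _ => hi t)).abs
  · exact (hw.abs.integrableOn_compact hD).const_mul _
  · intro u hu
    have h1 : φ u * w u - ∑ t ∈ S, C t * (b t u * w u) = (φ u - ∑ t ∈ S, C t * b t u) * w u := by
      rw [sub_mul, Finset.sum_mul]
      simp_rw [mul_assoc]
    rw [h1, abs_mul]
    by_cases hw0 : w u = 0
    · simp [hw0]
    · exact mul_le_mul_of_nonneg_right (h u hu hw0) (abs_nonneg _)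

theorem isCompact_window {h : ℝ} (hh : 0 < h) (y : ℝ) :
    IsCompact {u : ℝ | y + h * u ∈ Set.Icc (0 : ℝ) 1} := by
  have : {u : ℝ | y + h * u ∈ Set.Icc (0 : ℝ) 1} = Set.Icc (-y / h) ((1 - y) / h) := by
    ext u
    simp only [Set.mem_ofPred_eq, Set.mem_Icc, div_le_iff₀ hh, le_div_iff₀ hh]
    constructor <;> rintro ⟨h1, h2⟩ <;> constructor <;> linarith
  rw [this]
  exact isCompact_Icc

/-- The kernel's factor 1/h cancels the Jacobian of s = y + h u. -/
theorem integralDG_eq_window (G : ℝ → ℝ) {h : ℝ} (hh : 0 < h) (y : ℝ) (F Q : ℝ → ℝ) :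
    integralDG G (fun u => F u * (1 / h * Q ((u - y) / h))) =
      ∫ u in {u : ℝ | y + h * u ∈ Set.Icc (0 : ℝ) 1},
        F (y + h * u) * (Q u * weightDensity G (y + h * u)) := by
  rw [integralDG, setIntegral_eq_rescaled volume measurableSet_Icc _ y hh, Module.finrank_self,
    pow_one, ← integral_const_mul]
  simp only [smul_eq_mul]
  congr 1; ext u
  have : (y + h * u - y) / h = u := by field_simp; ring
  rw [this]
  field_simp

theorem tendsto_div_pow_of_abs_le {ι : Type*} {l : Filter ι} {h E N : ι → ℝ} {N₀ : ℝ} {M : ℕ}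
    (hpos : ∀ᶠ i in l, 0 < h i) (hN : Tendsto N l (𝓝 N₀))
    (hE : ∀ ε > 0, ∀ᶠ i in l, |E i| ≤ ε * h i ^ M * N i) :
    Tendsto (fun i => E i / h i ^ M) l (𝓝 0) := by
  rw [Metric.tendsto_nhds]
  intro ε hε
  have hb : ∀ᶠ i in l, N i < |N₀| + 1 :=
    hN.eventually_lt_const ((le_abs_self N₀).trans_lt (lt_add_one _))
  filter_upwards [hpos, hb, hE (ε / (|N₀| + 1)) (by positivity)] with i hi hNi hEi
  have hM : 0 < h i ^ M := pow_pos hi M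
  rw [Real.dist_eq, sub_zero, abs_div, abs_of_pos hM, div_lt_iff₀ hM]
  refine hEi.trans_lt ?_
  have : 0 < |N₀| + 1 := by positivity
  calc ε / (|N₀| + 1) * h i ^ M * N i < ε / (|N₀| + 1) * h i ^ M * (|N₀| + 1) := by gcongr
    _ = _ := by field_simp

section Brackets

variable {d : ℕ} {K G : ℝ → ℝ} {f : ℝ → (Fin d → ℝ) → ℝ} {p q μ M n : ℕ} {ν : Fin d → ℕ}
  {h y ε : ℝ} {x : Fin d → ℝ} {xs : ℕ → Fin d → ℝ} {θ : ℕ → (Fin d → ℕ) → ℝ}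

/-- Sample analogue of `c_{x,m}`. -/
noncomputable def cXhat (K : ℝ → ℝ) (q n : ℕ) (xs : ℕ → Fin d → ℝ) (m : Fin d → ℕ) (h : ℝ)
    (x : Fin d → ℝ) : multiIdx d q → ℝ := fun b => 1 / ((n : ℝ) * h ^ d) *
    ∑ i ∈ Finset.range n, mono m (scaled h x (xs i)) * QVec K q (scaled h x (xs i)) b

/-- Sample analogue of `c_{y,k}`. -/
noncomputable def cYhat (K : ℝ → ℝ) (p n : ℕ) (ys : ℕ → ℝ) (k : ℕ) (h y : ℝ) : Fin (p + 1) → ℝ :=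
  fun a => 1 / ((n : ℝ) * h) * ∑ j ∈ Finset.range n,
    ((ys j - y) / h) ^ k / (k.factorial : ℝ) * PVec K p ((ys j - y) / h) a

/-- The step common to both estimators: `I` is the inner average over the response and `γ` holds its
moments, so only the average over the covariates remains to be done. -/
theorem abs_bracket_sub_le (hK : IsKernelFun K) (hh : 0 < h)
    (hxs : ∀ i, xs i ∈ Set.Icc (0 : Fin d → ℝ) 1) {I : (Fin d → ℝ) → ℝ} {γ : ℕ → ℝ} {B : ℝ}
    (hI : ∀ w ∈ Set.Icc (0 : Fin d → ℝ) 1, ‖scaled h x w‖ ≤ 1 →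
      |I w - ∑ t ∈ degPairs d M, h ^ (t.1 + ∑ j, t.2 j) * θ t.1 t.2 *
        (γ t.1 * mono t.2 (scaled h x w))| ≤ B) (b : multiIdx d q) :
    |1 / ((n : ℝ) * h ^ d) * ∑ i ∈ Finset.range n, I (xs i) * QVec K q (scaled h x (xs i)) b -
      ∑ t ∈ degPairs d M, h ^ (t.1 + ∑ j, t.2 j) * θ t.1 t.2 *
        (γ t.1 * cXhat K q n xs t.2 h x b)| ≤
      B * (1 / ((n : ℝ) * h ^ d) *
        ∑ i ∈ Finset.range n, |QVec K q (scaled h x (xs i)) b|) := by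
  have h1 := abs_weighted_sum_sub_le (N := Finset.range n) (S := degPairs d M)
    (φ := fun i => I (xs i)) (w := fun i => QVec K q (scaled h x (xs i)) b)
    (C := fun t => h ^ (t.1 + ∑ j, t.2 j) * θ t.1 t.2)
    -- The response moment does not depend on `i`; this makes each term a product of a moment in y
    -- and a moment in x.
    (b := fun t i => γ t.1 * mono t.2 (scaled h x (xs i))) (B := B)
    (c := 1 / ((n : ℝ) * h ^ d)) (by positivity) (fun i _ hw => by
      refine hI _ (hxs i) ?_
      by_contra hv
      exact hw (hK.QVec_eq_zero (not_le.1 hv)))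
  convert h1 using 5 with t
  rw [cXhat, Finset.mul_sum, Finset.mul_sum, Finset.mul_sum]
  exact Finset.sum_congr rfl fun i _ => by ring

theorem abs_RbarMean_sub_le (hK : IsKernelFun K)
    (hg : ContinuousOn (weightDensity G) (Set.Icc 0 1)) (hh : 0 < h)
    (hxs : ∀ i, xs i ∈ Set.Icc (0 : Fin d → ℝ) 1)
    (hf : ∀ w ∈ Set.Icc (0 : Fin d → ℝ) 1, ContinuousOn (fun u => f u w) (Set.Icc 0 1))
    (hT : ∀ s ∈ Set.Icc (0 : ℝ) 1, ∀ w ∈ Set.Icc (0 : Fin d → ℝ) 1,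
      |(s - y) / h| ≤ 1 → ‖scaled h x w‖ ≤ 1 →
        |condCDF f s w - ∑ t ∈ degPairs d M, h ^ (t.1 + ∑ j, t.2 j) * θ t.1 t.2 *
          (((s - y) / h) ^ t.1 / (t.1.factorial : ℝ) * mono t.2 (scaled h x w))| ≤ ε)
    (a : Fin (p + 1)) (b : multiIdx d q) :
    |h ^ (μ + ∑ j, ν j) * RbarMean K G f p q μ ν n xs h y x a b -
      ∑ t ∈ degPairs d M, h ^ (t.1 + ∑ j, t.2 j) * θ t.1 t.2 *
        (cY K G p t.1 h y a * cXhat K q n xs t.2 h x b)| ≤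
      ε * (∫ u in {u : ℝ | y + h * u ∈ Set.Icc (0 : ℝ) 1},
        |PVec K p u a| * |weightDensity G (y + h * u)|) *
        (1 / ((n : ℝ) * h ^ d) * ∑ i ∈ Finset.range n, |QVec K q (scaled h x (xs i)) b|) := by
  have hmaps : Set.MapsTo (fun u : ℝ => y + h * u) {u : ℝ | y + h * u ∈ Set.Icc (0 : ℝ) 1}
    (Set.Icc 0 1) := fun u hu => hu
  have h1 := abs_bracket_sub_le (θ := θ) (M := M) (n := n) (x := x) hK hh hxs
    (I := fun w => integralDG G fun u => condCDF f u w * (1 / h * PVec K p ((u - y) / h) a))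
    (γ := fun k => cY K G p k h y a)
    (B := ε * ∫ u in {u : ℝ | y + h * u ∈ Set.Icc (0 : ℝ) 1},
        |PVec K p u a| * |weightDensity G (y + h * u)|) (fun w hw hv => by
      rw [integralDG_eq_window G hh y (fun s => condCDF f s w) fun u => PVec K p u a]
      have h2 := abs_setIntegral_sub_le (S := degPairs d M) (isCompact_window hh y)
        (φ := fun u => condCDF f (y + h * u) w)
        (w := fun u => PVec K p u a * weightDensity G (y + h * u))
        ((continuousOn_condCDF (hf w hw)).comp (by fun_prop) hmaps)
        ((hK.continuous_PVec p a).continuousOn.mul (hg.comp (by fun_prop) hmaps))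
        (C := fun t => h ^ (t.1 + ∑ j, t.2 j) * θ t.1 t.2)
        (b := fun t u => u ^ t.1 / (t.1.factorial : ℝ) * mono t.2 (scaled h x w)) (fun t => by fun_prop) (B := ε)
        (fun u hu hne => by
          have hu1 : |u| ≤ 1 := by
            by_contra hcon
            exact hne (by simp [hK.PVec_eq_zero (not_le.1 hcon)])
          have hus : (y + h * u - y) / h = u := by field_simp; ring
          have h3 := hT _ hu w hw (by rwa [hus]) hv
          rw [hus] at h3
          exact h3)
      simp only [abs_mul] at h2
      convert h2 using 5 with t
      rw [cY, ← integral_mul_const]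
      congr 1; ext u; ring) b
  convert h1 using 3
  have : h ^ (μ + ∑ j, ν j) ≠ 0 := (pow_pos hh _).ne'
  simp only [RbarMean, Matrix.of_apply]
  rw [← mul_assoc, Finset.mul_sum, Finset.mul_sum]
  refine Finset.sum_congr rfl fun i _ => ?_
  field_simp

theorem abs_RhatMean_sub_le (hK : IsKernelFun K) {ys : ℕ → ℝ} (hh : 0 < h)
    (hxs : ∀ i, xs i ∈ Set.Icc (0 : Fin d → ℝ) 1) (hys : ∀ i, ys i ∈ Set.Icc (0 : ℝ) 1)
    (hT : ∀ s ∈ Set.Icc (0 : ℝ) 1, ∀ w ∈ Set.Icc (0 : Fin d → ℝ) 1,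
      |(s - y) / h| ≤ 1 → ‖scaled h x w‖ ≤ 1 →
        |condCDF f s w - ∑ t ∈ degPairs d M, h ^ (t.1 + ∑ j, t.2 j) * θ t.1 t.2 *
          (((s - y) / h) ^ t.1 / (t.1.factorial : ℝ) * mono t.2 (scaled h x w))| ≤ ε)
    (a : Fin (p + 1)) (b : multiIdx d q) :
    |h ^ (μ + ∑ j, ν j) * RhatMean K f p q μ ν n ys xs h y x a b -
      ∑ t ∈ degPairs d M, h ^ (t.1 + ∑ j, t.2 j) * θ t.1 t.2 *
        (cYhat K p n ys t.1 h y a * cXhat K q n xs t.2 h x b)| ≤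
      ε * (1 / ((n : ℝ) * h) * ∑ j ∈ Finset.range n, |PVec K p ((ys j - y) / h) a|) *
        (1 / ((n : ℝ) * h ^ d) * ∑ i ∈ Finset.range n, |QVec K q (scaled h x (xs i)) b|) := by
  have h1 := abs_bracket_sub_le (θ := θ) (M := M) (n := n) (x := x) hK hh hxs
    (I := fun w => 1 / ((n : ℝ) * h) *
      ∑ j ∈ Finset.range n, condCDF f (ys j) w * PVec K p ((ys j - y) / h) a)
    (γ := fun k => cYhat K p n ys k h y a)
    (B := ε * (1 / ((n : ℝ) * h) * ∑ j ∈ Finset.range n, |PVec K p ((ys j - y) / h) a|))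
    (fun w hw hv => by
      have h2 := abs_weighted_sum_sub_le (N := Finset.range n) (S := degPairs d M)
        (φ := fun j => condCDF f (ys j) w) (w := fun j => PVec K p ((ys j - y) / h) a)
        (C := fun t => h ^ (t.1 + ∑ j, t.2 j) * θ t.1 t.2)
        (b := fun t j => ((ys j - y) / h) ^ t.1 / (t.1.factorial : ℝ) * mono t.2 (scaled h x w))
        (B := ε) (c := 1 / ((n : ℝ) * h)) (by positivity) (fun j _ hne => by
          refine hT _ (hys j) w hw ?_ hv
          by_contra hcon
          exact hne (hK.PVec_eq_zero (not_le.1 hcon)))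
      convert h2 using 5 with t
      rw [cYhat, Finset.mul_sum, Finset.mul_sum, Finset.sum_mul]
      exact Finset.sum_congr rfl fun i _ => by ring) b
  convert h1 using 3
  have : h ^ (μ + ∑ j, ν j) ≠ 0 := (pow_pos hh _).ne'
  simp only [RhatMean, Matrix.of_apply]
  rw [← mul_assoc, Finset.mul_sum, Finset.mul_sum]
  refine Finset.sum_congr rfl fun i _ => ?_
  rw [Finset.mul_sum, Finset.mul_sum, Finset.sum_mul, Finset.mul_sum]
  refine Finset.sum_congr rfl fun j _ => ?_
  field_simp

end Brackets

/-! ### Bandwidth rates and sample moments. -/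

theorem tendsto_mul_pow_of_rate {d : ℕ} {h : ℕ → ℝ} (hpos : ∀ n, 0 < h n)
    (hrate : Tendsto (fun n : ℕ => (n : ℝ) * h n ^ d / Real.log n) atTop atTop) :
    Tendsto (fun n : ℕ => (n : ℝ) * h n ^ d) atTop atTop := by
  refine tendsto_atTop_mono' _ ?_ hrate
  have hlog : Tendsto (fun n : ℕ => Real.log n) atTop atTop :=
    Real.tendsto_log_atTop.comp tendsto_natCast_atTop_atTop
  filter_upwards [hlog.eventually_ge_atTop 1] with n hn
  have := hpos n
  exact div_le_self (by positivity) hn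

/-- For d ≥ 1 and h ≤ 1 one has h^d ≤ h, so the rate for the covariates also covers the
one-dimensional average over the response. -/
theorem tendsto_mul_of_tendsto_mul_pow {d : ℕ} (hd : 1 ≤ d) {h : ℕ → ℝ} (hpos : ∀ n, 0 < h n)
    (hzero : Tendsto h atTop (𝓝 0))
    (hrate : Tendsto (fun n : ℕ => (n : ℝ) * h n ^ d) atTop atTop) :
    Tendsto (fun n : ℕ => (n : ℝ) * h n) atTop atTop := by
  refine tendsto_atTop_mono' _ ?_ hrate
  filter_upwards [hzero.eventually_le_const one_pos] with n hn
  exact mul_le_mul_of_nonneg_left (pow_le_of_le_one (hpos n).le hn (by omega)) (Nat.cast_nonneg n)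

namespace IsDGP

variable {Ω : Type*} [MeasurableSpace Ω] {P : Measure Ω} [IsProbabilityMeasure P] {d : ℕ}
  {Y : ℕ → Ω → ℝ} {X : ℕ → Ω → Fin d → ℝ} {f : ℝ → (Fin d → ℝ) → ℝ} (hD : IsDGP P Y X f)
  {h : ℕ → ℝ} (hpos : ∀ n, 0 < h n) (hzero : Tendsto h atTop (𝓝 0))
include hD hpos hzero

theorem tendstoInMeasure_average_X
    (hrate : Tendsto (fun n : ℕ => (n : ℝ) * h n ^ d) atTop atTop) {x : Fin d → ℝ}
    (hx : x ∈ Set.Icc (0 : Fin d → ℝ) 1) {φ : (Fin d → ℝ) → ℝ} (hφ : Continuous φ)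
    (hφs : HasCompactSupport φ) :
    TendstoInMeasure P (fun (n : ℕ) ω => 1 / ((n : ℝ) * h n ^ d) *
      ∑ i ∈ Finset.range n, φ (scaled (h n) x (X i ω))) atTop
      (fun _ => marginalX f x * ∫ v in coneX x, φ v) := by
  have hs : ∀ n ω i, scaled (h n) x (X i ω) = (h n)⁻¹ • (X i ω - x) := fun n ω i => by
    ext j; simp [scaled, div_eq_inv_mul]
  simp_rw [hs]
  have := tendstoInMeasure_rescaled_average volume hD.measurable_X hD.iIndepFun_X hD.map_X
    isCompact_Icc (measurableSet_coneX x) hx (eventually_mem_cube_iff hx)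
    hD.continuousOn_marginalX (fun F hF => hD.integral_X hF) hφ hφs hpos hzero
    (by rwa [Module.finrank_fin_fun])
  rwa [Module.finrank_fin_fun] at this

theorem tendstoInMeasure_average_Y
    (hrate : Tendsto (fun n : ℕ => (n : ℝ) * h n) atTop atTop) {y : ℝ}
    (hy : y ∈ Set.Icc (0 : ℝ) 1) {φ : ℝ → ℝ} (hφ : Continuous φ) (hφs : HasCompactSupport φ) :
    TendstoInMeasure P (fun (n : ℕ) ω => 1 / ((n : ℝ) * h n) *
      ∑ i ∈ Finset.range n, φ ((Y i ω - y) / h n)) atTop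
      (fun _ => marginalY f y * ∫ v in coneY y, φ v) := by
  have := tendstoInMeasure_rescaled_average volume hD.measurable_Y hD.iIndepFun_Y hD.map_Y
    isCompact_Icc (measurableSet_coneY y) hy (eventually_mem_Icc_iff hy)
    hD.continuousOn_marginalY (fun F hF => hD.integral_Y hF) hφ hφs hpos hzero
    (by simpa only [Module.finrank_self, pow_one] using hrate)
  simpa only [Module.finrank_self, pow_one, smul_eq_mul, ← div_eq_inv_mul] using this

end IsDGP

/-- The kernels of the sample moments in the covariates. -/
noncomputable def momentX {d : ℕ} (K : ℝ → ℝ) (q M : ℕ) (s : Option (multiIdx d M) × multiIdx d q)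
    (v : Fin d → ℝ) : ℝ :=
  -- The `none` entry is the absolute kernel, whose average multiplies the Taylor error.
  s.1.elim |QVec K q v s.2| fun m => mono m.1 v * QVec K q v s.2

/-- The kernels of the sample moments in the response. -/
noncomputable def momentY (K : ℝ → ℝ) (p M : ℕ) (s : Option (Fin (M + 1)) × Fin (p + 1))
    (u : ℝ) : ℝ :=
  s.1.elim |PVec K p u s.2| fun k => u ^ (k : ℕ) / ((k : ℕ).factorial : ℝ) * PVec K p u s.2

theorem continuous_momentX {K : ℝ → ℝ} (hK : IsKernelFun K) {d q M : ℕ}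
    (s : Option (multiIdx d M) × multiIdx d q) : Continuous (momentX K q M s) := by
  obtain ⟨_ | m, b⟩ := s
  · exact (hK.continuous_QVec q b).abs
  · exact (continuous_mono m.1).mul (hK.continuous_QVec q b)

theorem hasCompactSupport_momentX {K : ℝ → ℝ} (hK : IsKernelFun K) {d q M : ℕ}
    (s : Option (multiIdx d M) × multiIdx d q) : HasCompactSupport (momentX K q M s) := by
  obtain ⟨_ | m, b⟩ := s
  · exact (hK.hasCompactSupport_QVec q b).norm
  · exact (hK.hasCompactSupport_QVec q b).mul_left

theorem continuous_momentY {K : ℝ → ℝ} (hK : IsKernelFun K) {p M : ℕ}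
    (s : Option (Fin (M + 1)) × Fin (p + 1)) : Continuous (momentY K p M s) := by
  obtain ⟨_ | k, a⟩ := s
  · exact (hK.continuous_PVec p a).abs
  · exact ((continuous_pow (k : ℕ)).div_const _).mul (hK.continuous_PVec p a)

theorem hasCompactSupport_momentY {K : ℝ → ℝ} (hK : IsKernelFun K) {p M : ℕ}
    (s : Option (Fin (M + 1)) × Fin (p + 1)) : HasCompactSupport (momentY K p M s) := by
  obtain ⟨_ | k, a⟩ := s
  · exact (hK.hasCompactSupport_PVec p a).norm
  · exact (hK.hasCompactSupport_PVec p a).mul_left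

theorem SYhat_eq_cYhat (K : ℝ → ℝ) (p n : ℕ) (ys : ℕ → ℝ) (h y : ℝ) (a b : Fin (p + 1)) :
    SYhat K p n ys h y a b = cYhat K p n ys b h y a := by
  simp only [SYhat, cYhat, Matrix.of_apply, PVec, pVec]
  congr 1
  exact Finset.sum_congr rfl fun i _ => by ring

/-! ### The bias expansion along a filter on which the sample moments converge. -/

section Deterministic

variable {ι : Type*} {l : Filter ι} {d : ℕ} {K G : ℝ → ℝ} (hK : IsKernelFun K)
  (hg : ContinuousOn (weightDensity G) (Set.Icc 0 1)) {f : ℝ → (Fin d → ℝ) → ℝ}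
  (hf : ∀ w ∈ Set.Icc (0 : Fin d → ℝ) 1, ContinuousOn (fun u => f u w) (Set.Icc 0 1))
  (hfX : ContinuousOn (marginalX f) (Set.Icc 0 1)) {p q μ M : ℕ} {ν : Fin d → ℕ} (hμ : μ ≤ p)
  (hν : ∑ j, ν j ≤ q) (hM₁ : q + 1 + μ ≤ M) (hM₂ : p + 1 + ∑ j, ν j ≤ M)
  (hsmooth : ∀ (μ' : ℕ) (ν' : Fin d → ℕ), μ' + ∑ j, ν' j = M → ThetaExistsContinuous f μ' ν')
  {y : ℝ} (hy : y ∈ Set.Icc (0 : ℝ) 1) {x : Fin d → ℝ} (hx : x ∈ Set.Icc (0 : Fin d → ℝ) 1)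
  (hgy : weightDensity G y ≠ 0) (hfx : marginalX f x ≠ 0)
  {h : ι → ℝ} (hh : Tendsto h l (𝓝[>] 0)) {N : ι → ℕ} {xs : ι → ℕ → Fin d → ℝ}
  (hxs : ∀ᶠ i in l, ∀ j, xs i j ∈ Set.Icc (0 : Fin d → ℝ) 1)
  (hX : ∀ s, Tendsto (fun i => 1 / ((N i : ℝ) * h i ^ d) *
    ∑ j ∈ Finset.range (N i), momentX K q M s (scaled (h i) x (xs i j))) l
    (𝓝 (marginalX f x * ∫ v in coneX x, momentX K q M s v)))

include hX in
theorem tendsto_cXhat {m : Fin d → ℕ} (hm : ∑ j, m j ≤ M) :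
    Tendsto (fun i => cXhat K q (N i) (xs i) m (h i) x) l (𝓝 (marginalX f x • limX K q x m)) :=
  tendsto_pi_nhds.2 fun b => hX (some ⟨m, mem_multiIdx.2 hm⟩, b)

include hX in
theorem tendsto_SXhat (hqM : q ≤ M) :
    Tendsto (fun i => SXhat K q (N i) (xs i) (h i) x) l (𝓝 (marginalX f x • limSX K q x)) :=
  tendsto_pi_nhds.2 fun a => tendsto_pi_nhds.2 fun b =>
    tendsto_pi_nhds.1 (tendsto_cXhat hX ((mem_multiIdx.1 a.2).trans hqM)) b

include hK hfX hx hfx hh in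
theorem tendsto_cX_inv_SX (m : Fin d → ℕ) :
    Tendsto (fun i => cX K f q m (h i) x ⬝ᵥ (SX K f q (h i) x)⁻¹.mulVec (eX q ν)) l
      (𝓝 ((marginalX f x • limX K q x m) ⬝ᵥ
        (marginalX f x • limSX K q x)⁻¹.mulVec (eX q ν))) :=
  tendsto_dotProduct_mulVec ((tendsto_cX hK hx hfX q m).comp hh)
    (tendsto_matrix_inv ((tendsto_SX hK hx hfX q).comp hh)
      (det_smul_ne_zero (det_limSX_ne_zero hK q x) hfx)) tendsto_const_nhds

include hK hg hy hgy hh in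
-- The limit does not depend on the factor `r`, by `dotProduct_inv_smul_smul`. It may therefore be
-- written with g(y) for the first estimator and with the response density for the second.
theorem tendsto_cY_inv_SY {r : ℝ} (hr : r ≠ 0) (k : ℕ) :
    Tendsto (fun i => cY K G p k (h i) y ⬝ᵥ (SY K G p (h i) y)⁻¹.mulVec (eY p μ)) l
      (𝓝 (eY p μ ⬝ᵥ (r • limSY K p y)⁻¹.mulVec (r • limY K p y k))) := by
  have hdet := det_limSY_ne_zero hK p y
  rw [dotProduct_inv_smul_smul hdet (limSY_transpose K p y) hr,
    ← smul_dotProduct_inv_smul hdet hgy]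
  exact tendsto_dotProduct_mulVec ((tendsto_cY hK hy hg p k).comp hh)
    (tendsto_matrix_inv ((tendsto_SY hK hy hg p).comp hh) (det_smul_ne_zero hdet hgy))
    tendsto_const_nhds

include hK hg hf hsmooth hy hx hh hxs hX in
theorem tendsto_RbarMean_remainder (a : Fin (p + 1)) (b : multiIdx d q) :
    Tendsto (fun i => (h i ^ (μ + ∑ j, ν j) * RbarMean K G f p q μ ν (N i) (xs i) (h i) y x a b -
        ∑ s ∈ degPairs d M, h i ^ (s.1 + ∑ j, s.2 j) * theta f s.1 s.2 y x *
          (cY K G p s.1 (h i) y a * cXhat K q (N i) (xs i) s.2 (h i) x b)) / h i ^ M) l (𝓝 0) := by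
  have hpos : ∀ᶠ i in l, 0 < h i := (tendsto_nhdsWithin_iff.1 hh).2
  have hzero := (tendsto_nhdsWithin_iff.1 hh).1
  have hBy : Tendsto (fun i => ∫ u in {u : ℝ | y + h i * u ∈ Set.Icc (0 : ℝ) 1},
      |PVec K p u a| * |weightDensity G (y + h i * u)|) l
      (𝓝 (|weightDensity G y| * ∫ u in coneY y, |PVec K p u a|)) :=
    (tendsto_setIntegral_Icc hy hg.abs (hK.continuous_PVec p a).abs
      (hK.hasCompactSupport_PVec p a).norm).comp hh
  have hBx : Tendsto (fun i => 1 / ((N i : ℝ) * h i ^ d) *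
      ∑ j ∈ Finset.range (N i), |QVec K q (scaled (h i) x (xs i j)) b|) l
      (𝓝 (marginalX f x * ∫ v in coneX x, |QVec K q v b|)) := hX (none, b)
  refine tendsto_div_pow_of_abs_le hpos (hBy.mul hBx) fun ε hε => ?_
  obtain ⟨δ, hδ, hT⟩ := condCDF_taylor hsmooth hy hx hε
  filter_upwards [hpos, hxs, hzero.eventually_le_const hδ] with i hi hxi hδi
  exact (abs_RbarMean_sub_le (θ := fun k m => theta f k m y x) hK hg hi hxi hf (hT (h i) hi hδi) a b).trans_eq (mul_assoc _ _ _)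

include hK hsmooth hy hx hh hxs hX in
theorem tendsto_RhatMean_remainder {r : ℝ} {ys : ι → ℕ → ℝ}
    (hys : ∀ᶠ i in l, ∀ j, ys i j ∈ Set.Icc (0 : ℝ) 1)
    (hY : ∀ s, Tendsto (fun i => 1 / ((N i : ℝ) * h i) *
      ∑ j ∈ Finset.range (N i), momentY K p M s ((ys i j - y) / h i)) l
      (𝓝 (r * ∫ u in coneY y, momentY K p M s u))) (a : Fin (p + 1)) (b : multiIdx d q) :
    Tendsto (fun i => (h i ^ (μ + ∑ j, ν j) *
        RhatMean K f p q μ ν (N i) (ys i) (xs i) (h i) y x a b -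
        ∑ s ∈ degPairs d M, h i ^ (s.1 + ∑ j, s.2 j) * theta f s.1 s.2 y x *
          (cYhat K p (N i) (ys i) s.1 (h i) y a * cXhat K q (N i) (xs i) s.2 (h i) x b)) /
        h i ^ M) l (𝓝 0) := by
  have hpos : ∀ᶠ i in l, 0 < h i := (tendsto_nhdsWithin_iff.1 hh).2
  have hzero := (tendsto_nhdsWithin_iff.1 hh).1
  have hBy : Tendsto (fun i => 1 / ((N i : ℝ) * h i) *
      ∑ j ∈ Finset.range (N i), |PVec K p ((ys i j - y) / h i) a|) l
      (𝓝 (r * ∫ u in coneY y, |PVec K p u a|)) := hY (none, a)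
  have hBx : Tendsto (fun i => 1 / ((N i : ℝ) * h i ^ d) *
      ∑ j ∈ Finset.range (N i), |QVec K q (scaled (h i) x (xs i j)) b|) l
      (𝓝 (marginalX f x * ∫ v in coneX x, |QVec K q v b|)) := hX (none, b)
  refine tendsto_div_pow_of_abs_le hpos (hBy.mul hBx) fun ε hε => ?_
  obtain ⟨δ, hδ, hT⟩ := condCDF_taylor hsmooth hy hx hε
  filter_upwards [hpos, hxs, hys, hzero.eventually_le_const hδ] with i hi hxi hyi hδi
  exact (abs_RhatMean_sub_le (θ := fun k m => theta f k m y x) hK hi hxi hyi (hT (h i) hi hδi) a b).trans_eq (mul_assoc _ _ _)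

include hK hg hf hfX hμ hν hM₁ hM₂ hsmooth hy hx hgy hfx hh hxs hX

theorem tendsto_meanCheck_bias :
    Tendsto (fun i => (meanCheck K G f p q μ ν (N i) (xs i) (h i) y x -
      (theta f μ ν y x + leadingBias K G f p q μ ν (h i) y x)) / biasRate p q μ ν (h i)) l
      (𝓝 0) := by
  have hpos : ∀ᶠ i in l, 0 < h i := (tendsto_nhdsWithin_iff.1 hh).2
  have hzero := (tendsto_nhdsWithin_iff.1 hh).1
  have hSY : Tendsto (fun i => SY K G p (h i) y) l (𝓝 (weightDensity G y • limSY K p y)) :=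
    (tendsto_SY hK hy hg p).comp hh
  have hcY : ∀ k ≤ M, Tendsto (fun i => cY K G p k (h i) y) l
      (𝓝 (weightDensity G y • limY K p y k)) := fun k _ => (tendsto_cY hK hy hg p k).comp hh
  have hSX := tendsto_SXhat hX (by omega)
  have hα' := tendsto_cY_inv_SY (p := p) (μ := μ) hK hg hy hgy hh hgy (p + 1)
  have hβ' := fun m => tendsto_cX_inv_SX (q := q) (ν := ν) hK hfX hx hfx hh m
  have hE := tendsto_RbarMean_remainder (p := p) (μ := μ) (ν := ν) hK hg hf hsmooth hy hx hh hxs hX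
  simp only [meanCheck, leadingBias, biasRate]
  refine tendsto_sandwich_bias hμ hν hM₁ hM₂ hpos hzero (fun k m => theta f k m y x)
    hSY (det_smul_ne_zero (det_limSY_ne_zero hK p y) hgy)
    hSX (det_smul_ne_zero (det_limSX_ne_zero hK q x) hfx)
    (cy := fun k i => cY K G p k (h i) y) hcY
    (cx := fun m i => cXhat K q (N i) (xs i) m (h i) x) (fun m hm => tendsto_cXhat hX hm)
    (fun i k a => (SY_eq_cY p (h i) a k).symm) (fun i m b => rfl)
    (R := fun i => RbarMean K G f p q μ ν (N i) (xs i) (h i) y x)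
    -- The error is defined as the difference, so the expansion of the bracket is an identity and
    -- all content lies in `hE`.
    (E := fun i => Matrix.of fun a b =>
      h i ^ (μ + ∑ j, ν j) * RbarMean K G f p q μ ν (N i) (xs i) (h i) y x a b -
        ∑ s ∈ degPairs d M, h i ^ (s.1 + ∑ j, s.2 j) * theta f s.1 s.2 y x *
          (cY K G p s.1 (h i) y a * cXhat K q (N i) (xs i) s.2 (h i) x b))
    (Eventually.of_forall fun i a b => by rw [Matrix.of_apply]; ring) (fun a b => hE a b)
    hα' hβ'

omit hf in
theorem tendsto_meanHat_bias {r : ℝ} (hr : r ≠ 0) {ys : ι → ℕ → ℝ}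
    (hys : ∀ᶠ i in l, ∀ j, ys i j ∈ Set.Icc (0 : ℝ) 1)
    (hY : ∀ s, Tendsto (fun i => 1 / ((N i : ℝ) * h i) *
      ∑ j ∈ Finset.range (N i), momentY K p M s ((ys i j - y) / h i)) l
      (𝓝 (r * ∫ u in coneY y, momentY K p M s u))) :
    Tendsto (fun i => (meanHat K f p q μ ν (N i) (ys i) (xs i) (h i) y x -
      (theta f μ ν y x + leadingBias K G f p q μ ν (h i) y x)) / biasRate p q μ ν (h i)) l
      (𝓝 0) := by
  have hpos : ∀ᶠ i in l, 0 < h i := (tendsto_nhdsWithin_iff.1 hh).2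
  have hzero := (tendsto_nhdsWithin_iff.1 hh).1
  have hcY : ∀ k ≤ M, Tendsto (fun i => cYhat K p (N i) (ys i) k (h i) y) l
      (𝓝 (r • limY K p y k)) := fun k hk =>
    tendsto_pi_nhds.2 fun a => hY (some ⟨k, by omega⟩, a)
  have hSY : Tendsto (fun i => SYhat K p (N i) (ys i) (h i) y) l (𝓝 (r • limSY K p y)) := by
    refine tendsto_pi_nhds.2 fun a => tendsto_pi_nhds.2 fun b => ?_
    simp_rw [SYhat_eq_cYhat]
    rw [Matrix.smul_apply, limSY_eq_limY]
    exact tendsto_pi_nhds.1 (hcY b (by omega)) a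
  have hSX := tendsto_SXhat hX (by omega)
  have hα' := tendsto_cY_inv_SY (p := p) (μ := μ) hK hg hy hgy hh hr (p + 1)
  have hβ' := fun m => tendsto_cX_inv_SX (q := q) (ν := ν) hK hfX hx hfx hh m
  have hE := tendsto_RhatMean_remainder (μ := μ) (ν := ν) hK hsmooth hy hx hh hxs hX hys hY
  simp only [meanHat, leadingBias, biasRate]
  refine tendsto_sandwich_bias hμ hν hM₁ hM₂ hpos hzero (fun k m => theta f k m y x)
    hSY (det_smul_ne_zero (det_limSY_ne_zero hK p y) hr)
    hSX (det_smul_ne_zero (det_limSX_ne_zero hK q x) hfx)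
    (cy := fun k i => cYhat K p (N i) (ys i) k (h i) y) hcY
    (cx := fun m i => cXhat K q (N i) (xs i) m (h i) x) (fun m hm => tendsto_cXhat hX hm)
    (fun i k a => (SYhat_eq_cYhat K p (N i) (ys i) (h i) y a k).symm) (fun i m b => rfl)
    (R := fun i => RhatMean K f p q μ ν (N i) (ys i) (xs i) (h i) y x)
    (E := fun i => Matrix.of fun a b =>
      h i ^ (μ + ∑ j, ν j) * RhatMean K f p q μ ν (N i) (ys i) (xs i) (h i) y x a b -
        ∑ s ∈ degPairs d M, h i ^ (s.1 + ∑ j, s.2 j) * theta f s.1 s.2 y x *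
          (cYhat K p (N i) (ys i) s.1 (h i) y a * cXhat K q (N i) (xs i) s.2 (h i) x b))
    (Eventually.of_forall fun i a b => by rw [Matrix.of_apply]; ring) (fun a b => hE a b)
    hα' hβ'

end Deterministic

end CondDist

/-! ### The theorem. -/

theorem mainTheorem8 {Ω : Type*} [MeasurableSpace Ω] (P : Measure Ω) [IsProbabilityMeasure P]
    (d : ℕ) (hd : 1 ≤ d)
    (Y : ℕ → Ω → ℝ) (X : ℕ → Ω → Fin d → ℝ) (f : ℝ → (Fin d → ℝ) → ℝ)
    (hDGP : CondDist.IsDGP P Y X f)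
    (K : ℝ → ℝ) (hK : CondDist.IsKernelFun K)
    (G : ℝ → ℝ) (hG : ContDiffOn ℝ 1 G (Set.Icc 0 1))
    (h : ℕ → ℝ) (hpos : ∀ n, 0 < h n) (hzero : Tendsto h atTop (𝓝 0))
    (hrate : Tendsto (fun n : ℕ => (n : ℝ) * h n ^ d / Real.log n) atTop atTop)
    (p q μ : ℕ) (ν : Fin d → ℕ) (hμ : μ ≤ p) (hν : ∑ j, ν j ≤ q)
    (hsmooth : ∀ (μ' : ℕ) (ν' : Fin d → ℕ),
      μ' + ∑ j, ν' j = max (q + 1 + μ) (p + 1 + ∑ j, ν j) →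
        CondDist.ThetaExistsContinuous f μ' ν')
    (y : ℝ) (hy : y ∈ Set.Icc (0 : ℝ) 1) (x : Fin d → ℝ) (hx : x ∈ Set.Icc (0 : Fin d → ℝ) 1)
    (hgy : CondDist.weightDensity G y ≠ 0) :
    TendstoInMeasure P
      (fun (n : ℕ) (ω : Ω) =>
        (CondDist.meanCheck K G f p q μ ν n (fun i => X i ω) (h n) y x
          - (CondDist.theta f μ ν y x + CondDist.leadingBias K G f p q μ ν (h n) y x))
        / CondDist.biasRate p q μ ν (h n))
      atTop (fun _ => (0 : ℝ)) ∧
    TendstoInMeasure P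
      (fun (n : ℕ) (ω : Ω) =>
        (CondDist.meanHat K f p q μ ν n (fun i => Y i ω) (fun i => X i ω) (h n) y x
          - (CondDist.theta f μ ν y x + CondDist.leadingBias K G f p q μ ν (h n) y x))
        / CondDist.biasRate p q μ ν (h n))
      atTop (fun _ => (0 : ℝ)) := by
  have hg : ContinuousOn (CondDist.weightDensity G) (Set.Icc 0 1) :=
    hG.continuousOn_derivWithin (uniqueDiffOn_Icc zero_lt_one) le_rfl
  have hrX := CondDist.tendsto_mul_pow_of_rate hpos hrate
  have hrY := CondDist.tendsto_mul_of_tendsto_mul_pow hd hpos hzero hrX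
  set M := max (q + 1 + μ) (p + 1 + ∑ j, ν j) with hM
  have hM₁ : q + 1 + μ ≤ M := le_max_left _ _
  have hM₂ : p + 1 + ∑ j, ν j ≤ M := le_max_right _ _
  -- Almost surely all observations lie in the cube at once, where the Taylor expansion is
  -- available.
  set good : Set Ω := {ω | ∀ i, Y i ω ∈ Set.Icc (0 : ℝ) 1 ∧ X i ω ∈ Set.Icc (0 : Fin d → ℝ) 1}
  have hgood : P goodᶜ = 0 := ae_all_iff.2 fun i => hDGP.ae_mem i
  -- The finite family of statistics that carries all the randomness: moments of the covariates and
  -- of the response.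
  set T : (Option (CondDist.multiIdx d M) × CondDist.multiIdx d q) ⊕
      (Option (Fin (M + 1)) × Fin (p + 1)) → ℕ → Ω → ℝ := Sum.elim
    (fun s n ω => 1 / ((n : ℝ) * h n ^ d) *
      ∑ i ∈ Finset.range n, CondDist.momentX K q M s (CondDist.scaled (h n) x (X i ω)))
    (fun s n ω => 1 / ((n : ℝ) * h n) *
      ∑ i ∈ Finset.range n, CondDist.momentY K p M s ((Y i ω - y) / h n))
  set t : (Option (CondDist.multiIdx d M) × CondDist.multiIdx d q) ⊕
      (Option (Fin (M + 1)) × Fin (p + 1)) → ℝ := Sum.elim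
    (fun s => CondDist.marginalX f x * ∫ v in CondDist.coneX x, CondDist.momentX K q M s v)
    (fun s => CondDist.marginalY f y * ∫ u in CondDist.coneY y, CondDist.momentY K p M s u)
  have hT : ∀ k, TendstoInMeasure P (T k) atTop fun _ => t k := by
    rintro (s | s)
    · exact hDGP.tendstoInMeasure_average_X hpos hzero hrX hx
        (CondDist.continuous_momentX hK s) (CondDist.hasCompactSupport_momentX hK s)
    · exact hDGP.tendstoInMeasure_average_Y hpos hzero hrY hy
        (CondDist.continuous_momentY hK s) (CondDist.hasCompactSupport_momentY hK s)
  have hh : Tendsto h atTop (𝓝[>] 0) :=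
    tendsto_nhdsWithin_iff.2 ⟨hzero, Eventually.of_forall hpos⟩
  constructor
  · refine CondDist.tendstoInMeasure_of_statistics hT hgood fun l hl hgl hTl => ?_
    exact CondDist.tendsto_meanCheck_bias hK hg (fun w hw => hDGP.continuousOn_left hw)
      hDGP.continuousOn_marginalX hμ hν hM₁ hM₂ hsmooth hy hx hgy (hDGP.marginalX_pos hx).ne'
      (hh.comp hl) (N := Prod.fst) (xs := fun i j => X j i.2)
      (hgl.mono fun i hi j => (hi j).2) (fun s => hTl (Sum.inl s))
  · refine CondDist.tendstoInMeasure_of_statistics hT hgood fun l hl hgl hTl => ?_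
    exact CondDist.tendsto_meanHat_bias hK hg
      hDGP.continuousOn_marginalX hμ hν hM₁ hM₂ hsmooth hy hx hgy (hDGP.marginalX_pos hx).ne'
      (hh.comp hl) (N := Prod.fst) (xs := fun i j => X j i.2)
      (hgl.mono fun i hi j => (hi j).2) (fun s => hTl (Sum.inl s)) (hDGP.marginalY_pos hy).ne'
      (ys := fun i j => Y j i.2) (hgl.mono fun i hi j => (hi j).1) (fun s => hTl (Sum.inr s))
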